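/- Let $d\ge1$ be an integer, $\alpha>0$, $\beta\in(0,1]$ with $\alpha\beta\le1$, and $L>0$, $\delta_0\in(0,1)$, $D_0>0$; if $\alpha\beta=d$ (that is, $d=1$ and $\alpha\beta=1$), assume in addition that $D_0(2L)^\alpha\ge1$. Put $$\gamma=\frac{\beta(1+\alpha)}{2\beta+d}\in(0,1).$$ *Instances.* Let $P_X$ be the uniform distribution on $\mathcal X=[0,1]^d$. A bandit instance with horizon $T$ consists of i.i.d. vectors $(X_t,Y_t^{(1)},Y_t^{(-1)})$, $t=1,\dots,T$, with $X_t\sim P_X$, $Y_t^{(k)}\in[0,1]$ and $\mathbb E[Y_t^{(k)}\mid X_t]=f^{(k)}(X_t)$ for $k\in\{1,-1\}$. The class $\mathcal F(\alpha,\beta)$ consists of the instances with $|f^{(k)}(x)-f^{(k)}(x')|\le L\|x-x'\|_2^\beta$ for all $x,x'\in\mathcal X$ and $k\in\{1,-1\}$, and with $P_X\big(0<|f^{(1)}(X)-f^{(-1)}(X)|\le\delta\big)\le D_0\delta^\alpha$ for all $\delta\in[0,\delta_0]$. *Policies.* An $M$-batch policy $(\Gamma,\pi)$ with horizon $T$ (it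 may use a private random seed independent of the instance) chooses grid points $0=t_0<t_1<\dots<t_M=T$ and, in every round $t$, an arm $A_t=\pi_t(X_t)\in\{1,-1\}$. The grid may be adaptive: $t_i$ is a function of the seed and of $(X_l,Y_l^{(A_l)})_{l\le t_{i-1}}$. For $t_{i-1}<t\le t_i$ the arm $A_t$ is a function of the seed, of $X_1,\dots,X_t$, and of the rewards $Y_l^{(A_l)}$ with $l\le t_{i-1}$. Its regret on an instance is $$R_T(\pi)=\mathbb E\Big[\sum_{t=1}^T\Big(\max_{k\in\{1,-1\}}f^{(k)}(X_t)-f^{(A_t)}(X_t)\Big)\Big].$$ *Theorem.* There are constants $\tilde D_1,\tilde D_2>0$, depending only on $d,\alpha,\beta,L,\delta_0,D_0$ (in particular not on $T$, $M$ or the policy), such that for all integers $T\ge 1$ and $M\ge1$ and every $M$-batch policy $(\Gamma,\pi)$ with horizon $T$ there is an instance in $\mathcal F(\alpha,\beta)$ on which $$R_T(\pi)\ \ge\ \tilde D_1\Big(\frac1M\Big)^{\tilde D_2}\,T^{\frac{1-\gamma}{1-\gamma^M}} .$$ -/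

import Mathlib

open MeasureTheory

namespace BatchedBandit

/-- The two arms: `true` is arm `1` and `false` is arm `-1`. -/
abbrev Arm : Type := Bool

/-- The ambient Euclidean space of the contexts. -/
abbrev Ctx (d : ℕ) : Type := EuclideanSpace ℝ (Fin d)

/-- The context space `[0,1]^d`. -/
def cube (d : ℕ) : Set (Ctx d) := {x | ∀ i, x i ∈ Set.Icc (0 : ℝ) 1}

/-- The uniform distribution on `[0,1]^d` (a set of Lebesgue measure one). -/
noncomputable def uniformCube (d : ℕ) : Measure (Ctx d) :=
  (volume : Measure (Ctx d)).restrict (cube d)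

/-- One round of the game: the context and the potential rewards of both arms. -/
abbrev Round (d : ℕ) : Type := Ctx d × (Arm → ℝ)

/-- A nonparametric two-arm bandit instance: the common law of the i.i.d. vectors
`(X_t, Y_t^(1), Y_t^(-1))`, with rewards in `[0,1]`, and mean reward functions `f^(k)` such that
`E[Y_t^(k) | X_t] = f^(k)(X_t)`. -/
structure Instance (d : ℕ) where
  law : Measure (Round d)
  mean : Arm → Ctx d → ℝ
  isProbabilityMeasure_law : IsProbabilityMeasure law
  reward_mem : ∀ k, ∀ᵐ z ∂law, z.2 k ∈ Set.Icc (0 : ℝ) 1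
  condExp_reward : ∀ k,
    law[(fun z : Round d => z.2 k) | MeasurableSpace.comap Prod.fst inferInstance]
      =ᵐ[law] fun z => mean k z.1

/-- Both mean reward functions are `(β, L)`-smooth on `[0,1]^d`. -/
def Smooth {d : ℕ} (β L : ℝ) (f : Arm → Ctx d → ℝ) : Prop :=
  ∀ k, ∀ x ∈ cube d, ∀ y ∈ cube d, |f k x - f k y| ≤ L * ‖x - y‖ ^ β

/-- The margin condition with parameter `α` and constants `δ₀`, `D₀`. -/
def Margin {d : ℕ} (PX : Measure (Ctx d)) (α δ₀ D₀ : ℝ) (f : Arm → Ctx d → ℝ) : Prop :=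
  ∀ δ ∈ Set.Icc (0 : ℝ) δ₀,
    PX.real {x | 0 < |f true x - f false x| ∧ |f true x - f false x| ≤ δ} ≤ D₀ * δ ^ α

/-- The class `𝓕(α, β)` of bandit instances with context law `PX`, where `L`, `δ₀` and `D₀` are the
constants in the smoothness and margin conditions. -/
def instanceClass {d : ℕ} (PX : Measure (Ctx d)) (α β L δ₀ D₀ : ℝ) : Set (Instance d) :=
  {I | I.law.map Prod.fst = PX ∧ Smooth β L I.mean ∧ Margin PX α δ₀ D₀ I.mean}

/-- The canonical sample space of a game with horizon `T`: the statistician's private random seed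
and the `T` rounds. The index `t : Fin T` stands for the time `t + 1`. -/
abbrev Sample (d T : ℕ) (S : Type*) : Type _ := S × (Fin T → Round d)

/-- The samples `ω` and `ω'` look the same once the first `n` rounds have been fully observed: they
have the same seed, and in the rounds `1, …, n` the same contexts and the same rewards of the pulled
arms. -/
def SameObs {d T : ℕ} {S : Type*} (action : Fin T → Sample d T S → Arm) (n : ℕ)
    (ω ω' : Sample d T S) : Prop :=
  ω.1 = ω'.1 ∧ ∀ l : Fin T, (l : ℕ) < n →
    (ω.2 l).1 = (ω'.2 l).1 ∧ (ω.2 l).2 (action l ω) = (ω'.2 l).2 (action l ω')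

/-- An `M`-batch policy with horizon `T`, an adaptively chosen grid and random seeds in `S`.
`grid i ω` is the grid point `t_i`, and `action t ω` is the arm `π_t(X_t)` pulled in round `t`.
The grid point `t_{i+1}` depends only on the seed and on the contexts and observed rewards of the
rounds up to `t_i`; an action in the batch `t_i < t ≤ t_{i+1}` depends only on these and
on the contexts up to (and including) time `t`. -/
structure BatchPolicy (d T M : ℕ) (S : Type*) [MeasurableSpace S] where
  grid : ℕ → Sample d T S → ℕ
  action : Fin T → Sample d T S → Arm
  measurable_grid : ∀ i ≤ M, Measurable (grid i)
  measurable_action : ∀ t, Measurable (action t)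
  grid_zero : ∀ ω, grid 0 ω = 0
  grid_lt : ∀ i < M, ∀ ω, grid i ω < grid (i + 1) ω
  grid_last : ∀ ω, grid M ω = T
  grid_adapted : ∀ i < M, ∀ ω ω', SameObs action (grid i ω) ω ω' →
    grid (i + 1) ω = grid (i + 1) ω'
  action_adapted : ∀ i < M, ∀ t : Fin T, ∀ ω ω',
    grid i ω ≤ (t : ℕ) → (t : ℕ) < grid (i + 1) ω →
    SameObs action (grid i ω) ω ω' → (∀ l ≤ t, (ω.2 l).1 = (ω'.2 l).1) →
    action t ω = action t ω'

/-- The law of the sample: the seed has law `ν` and is independent of the `T` i.i.d. rounds. -/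
noncomputable def sampleLaw {d : ℕ} (T : ℕ) {S : Type*} [MeasurableSpace S] (ν : Measure S)
    (I : Instance d) : Measure (Sample d T S) :=
  ν.prod (Measure.pi fun _ : Fin T => I.law)

/-- The expected cumulative regret `R_T(π)`. -/
noncomputable def regret {d T M : ℕ} {S : Type*} [MeasurableSpace S] (ν : Measure S)
    (p : BatchPolicy d T M S) (I : Instance d) : ℝ :=
  ∫ ω, ∑ t : Fin T, (max (I.mean true (ω.2 t).1) (I.mean false (ω.2 t).1)
    - I.mean (p.action t ω) (ω.2 t).1) ∂(sampleLaw T ν I)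

/-- The exponent `γ = β(1 + α) / (2β + d)`. -/
noncomputable def gammaExp (d : ℕ) (α β : ℝ) : ℝ := β * (1 + α) / (2 * β + d)

end BatchedBandit

/-! The instances are perturbations of the fair game in which exactly one arm pays off, arm `1` with
probability `(1 + g x) / 2`; the gap `g` is a sum of signed Hölder bumps. One reward then reveals
both, so the bound holds even against full feedback at the end of every batch.

Write `τ i = T ^ ((1 - γ ^ i) / (1 - γ ^ M))`, so that `τ 0 = 1`, `τ M = T` and `τ (i + 1) = T ^ ((1
- γ) / (1 - γ ^ M)) * τ i ^ γ`. `exists_thresholds` turns this into integers `a i`, at most `τ i`,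
with gaps of order `τ (i + 1) / M`. By pigeonhole, any grid has a batch `i` that starts by time `a
i` and ends after `a (i + 1)` (`BatchPolicy.exists_batchEvent`). All decisions between `a i` and `a
(i + 1)` then use rewards of the first `a i` rounds only.

Bumps of radius `r i`, of order `τ i ^ (-1 / (2β + d))` up to powers of `1 / M`, have a squared `L²`
norm of order `r i ^ (2β + d)`, so `a i` rounds do not determine their signs (`integral_test_le`).
The margin condition allows about `r i ^ (αβ - d)` of them, each of mass about `r i ^ (β + d)`. A
round in the window therefore costs about `r i ^ (β(1 + α))`, which cancels `τ i ^ γ`. Every scale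
leads to the same regret, up to powers of `M`.

The index of the bad batch is unknown in advance and depends on the policy and its seed. If `αβ <
d`, the bumps of all `M` scales live side by side in disjoint boxes with independent random signs:
under this single prior some batch covers its window with average probability at least `1 / M`
(`exists_le_regret_of_bumps`). If `αβ = d = 1`, there may be room for only one bump; its scale and
sign are drawn at random and all comparisons are made with the zero gap
(`exists_le_regret_of_single_bump`). -/

namespace BatchedBandit

/-! ### Instances with a prescribed gap. -/

/-- The reward vector in which arm `a` earns `1` and the other arm earns `0`. -/
def unitReward (a : Arm) : Arm → ℝ := fun k => if k = a then 1 else 0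

/-- The law of the reward vector of a fair pair of arms exactly one of which pays off. -/
noncomputable def coin : Measure (Arm → ℝ) :=
  (2⁻¹ : ENNReal) • (Measure.dirac (unitReward true) + Measure.dirac (unitReward false))

instance : IsProbabilityMeasure coin := by
  constructor
  simp only [coin, Measure.smul_apply, Measure.add_apply, measure_univ, smul_eq_mul]
  rw [one_add_one_eq_two, ENNReal.inv_mul_cancel] <;> norm_num

lemma integral_coin (F : (Arm → ℝ) → ℝ) (hF : Measurable F) :
    ∫ y, F y ∂coin = (F (unitReward true) + F (unitReward false)) / 2 := by
  unfold coin
  rw [integral_smul_measure, integral_add_measure, integral_dirac' _ _ hF.stronglyMeasurable,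
    integral_dirac' _ _ hF.stronglyMeasurable]
  · simp; ring
  · exact integrable_dirac' hF.stronglyMeasurable (by simp)
  · exact integrable_dirac' hF.stronglyMeasurable (by simp)

lemma ae_coin (P : (Arm → ℝ) → Prop) (h1 : P (unitReward true)) (h2 : P (unitReward false)) :
    ∀ᵐ y ∂coin, P y := by
  unfold coin
  refine Measure.ae_smul_measure ?_ _
  rw [ae_add_measure_iff]
  constructor
  · rw [ae_dirac_eq]; exact h1
  · rw [ae_dirac_eq]; exact h2

lemma cube_eq_preimage (d : ℕ) :
    cube d = (MeasurableEquiv.toLp 2 (Fin d → ℝ)).symm ⁻¹' (Set.Icc 0 1) := by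
  ext x
  simp only [cube, Set.mem_ofPred_eq, Set.mem_preimage, Set.mem_Icc, Pi.le_def]
  constructor
  · intro h; exact ⟨fun i => (h i).1, fun i => (h i).2⟩
  · intro h i; exact ⟨h.1 i, h.2 i⟩

lemma measurableSet_cube (d : ℕ) : MeasurableSet (cube d) := by
  rw [cube_eq_preimage]
  exact (MeasurableEquiv.measurable _) measurableSet_Icc

lemma volume_cube (d : ℕ) : (volume : Measure (Ctx d)) (cube d) = 1 := by
  rw [cube_eq_preimage]
  rw [(EuclideanSpace.volume_preserving_symm_measurableEquiv_toLp (Fin d)).measure_preimage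
    measurableSet_Icc.nullMeasurableSet, Real.volume_Icc_pi]
  simp

instance (d : ℕ) : IsProbabilityMeasure (uniformCube d) := by
  constructor
  simp [uniformCube, volume_cube]

/-- The law of a round in which both arms have mean `1/2` in all contexts. -/
noncomputable def nullLaw (d : ℕ) : Measure (Round d) := (uniformCube d).prod coin

instance (d : ℕ) : IsProbabilityMeasure (nullLaw d) := by unfold nullLaw; infer_instance

/-- Admissible gaps `f^(1) - f^(-1)`. -/
structure IsGap {d : ℕ} (g : Ctx d → ℝ) : Prop where
  meas : Measurable g
  bound : ∀ x, |g x| ≤ 1 / 2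

/-- The density, with respect to `nullLaw`, of a round with gap `g`. -/
noncomputable def gapDensity {d : ℕ} (g : Ctx d → ℝ) (z : Round d) : ℝ :=
  1 + (max (min (z.2 true - z.2 false) 1) (-1)) * g z.1

/-- The clamp of the reward difference in `gapDensity` is inactive on the unit reward vectors, which
carry all the mass; it makes the density bounded and bounded away from zero at every point. -/
lemma gapDensity_bounds {d : ℕ} {g : Ctx d → ℝ} (hg : IsGap g) (z : Round d) :
    1 / 2 ≤ gapDensity g z ∧ gapDensity g z ≤ 3 / 2 := by
  unfold gapDensity
  set s := max (min (z.2 true - z.2 false) 1) (-1)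
  have h1 : |s| ≤ 1 := abs_le.2 ⟨le_max_right _ _, max_le (min_le_right _ _) (by norm_num)⟩
  have h2 : |s * g z.1| ≤ 1 / 2 := by
    rw [abs_mul]
    calc _ ≤ 1 * (1 / 2) := mul_le_mul h1 (hg.bound _) (abs_nonneg _) (by norm_num)
      _ = _ := by norm_num
  have := abs_le.1 h2
  constructor <;> linarith

lemma measurable_gapDensity {d : ℕ} {g : Ctx d → ℝ} (hg : IsGap g) :
    Measurable (gapDensity g) := by
  unfold gapDensity
  have := hg.meas
  fun_prop

lemma gapDensity_unitReward {d : ℕ} (g : Ctx d → ℝ) (x : Ctx d) :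
    gapDensity g (x, unitReward true) = 1 + g x ∧
      gapDensity g (x, unitReward false) = 1 - g x := by
  unfold gapDensity unitReward
  constructor <;> simp
  ring

/-- The law of a round with gap `g`. -/
noncomputable def gapLaw {d : ℕ} (g : Ctx d → ℝ) : Measure (Round d) :=
  (nullLaw d).withDensity fun z => ENNReal.ofReal (gapDensity g z)

lemma integrable_of_bound {X : Type*} [MeasurableSpace X] {μ : Measure X} [IsFiniteMeasure μ]
    {F : X → ℝ} (hF : Measurable F) {C : ℝ} (hC : ∀ z, |F z| ≤ C) : Integrable F μ :=
  Integrable.of_bound hF.aestronglyMeasurable C (Filter.Eventually.of_forall hC)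

lemma integral_nullLaw {d : ℕ} {F : Round d → ℝ} (hF : Integrable F (nullLaw d))
    (hm : Measurable F) :
    ∫ z, F z ∂(nullLaw d)
      = ∫ x, (F (x, unitReward true) + F (x, unitReward false)) / 2 ∂(uniformCube d) := by
  unfold nullLaw at *
  rw [integral_prod _ hF]
  refine integral_congr_ae (Filter.Eventually.of_forall fun x => ?_)
  exact integral_coin _ (hm.comp (measurable_prodMk_left))

lemma integral_gapLaw_eq_nullLaw {d : ℕ} {g : Ctx d → ℝ} (hg : IsGap g) (F : Round d → ℝ) :
    ∫ z, F z ∂(gapLaw g) = ∫ z, gapDensity g z * F z ∂(nullLaw d) := by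
  unfold gapLaw
  rw [integral_withDensity_eq_integral_toReal_smul
    (measurable_gapDensity hg).ennreal_ofReal (Filter.Eventually.of_forall fun _ => by simp)]
  refine integral_congr_ae (Filter.Eventually.of_forall fun z => ?_)
  simp only [smul_eq_mul]
  rw [ENNReal.toReal_ofReal (by linarith [(gapDensity_bounds hg z).1])]

lemma integral_gapLaw {d : ℕ} {g : Ctx d → ℝ} (hg : IsGap g) {F : Round d → ℝ}
    (hm : Measurable F) {C : ℝ} (hC : ∀ z, |F z| ≤ C) :
    ∫ z, F z ∂(gapLaw g)
      = ∫ x, ((1 + g x) * F (x, unitReward true) + (1 - g x) * F (x, unitReward false)) / 2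
          ∂(uniformCube d) := by
  rw [integral_gapLaw_eq_nullLaw hg, integral_nullLaw]
  · refine integral_congr_ae (Filter.Eventually.of_forall fun x => ?_)
    simp only [(gapDensity_unitReward g x).1, (gapDensity_unitReward g x).2]
  · refine integrable_of_bound ((measurable_gapDensity hg).mul hm) (C := 3 / 2 * C) fun z => ?_
    rw [abs_mul]
    have h := gapDensity_bounds hg z
    refine mul_le_mul (abs_le.2 ⟨by linarith, h.2⟩) (hC z) (abs_nonneg _) (by norm_num)
  · exact (measurable_gapDensity hg).mul hm

lemma isProbabilityMeasure_gapLaw {d : ℕ} {g : Ctx d → ℝ} (hg : IsGap g) :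
    IsProbabilityMeasure (gapLaw g) := by
  constructor
  have hi : Integrable (gapDensity g) (nullLaw d) :=
    integrable_of_bound (measurable_gapDensity hg) (C := 3 / 2) fun z => by
      have h := gapDensity_bounds hg z
      exact abs_le.2 ⟨by linarith, h.2⟩
  have h0 : ∀ z, 0 ≤ gapDensity g z := fun z => by linarith [(gapDensity_bounds hg z).1]
  unfold gapLaw
  rw [withDensity_apply _ MeasurableSet.univ, Measure.restrict_univ,
    ← ofReal_integral_eq_lintegral_ofReal hi (Filter.Eventually.of_forall h0),
    integral_nullLaw hi (measurable_gapDensity hg)]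
  simp [(gapDensity_unitReward g _).1, (gapDensity_unitReward g _).2]

lemma map_fst_gapLaw {d : ℕ} {g : Ctx d → ℝ} (hg : IsGap g) :
    (gapLaw g).map Prod.fst = uniformCube d := by
  have := isProbabilityMeasure_gapLaw hg
  have : IsProbabilityMeasure ((gapLaw g).map Prod.fst) :=
    Measure.isProbabilityMeasure_map measurable_fst.aemeasurable
  refine Measure.ext fun s hs => ?_
  rw [← measureReal_eq_measureReal_iff, ← integral_indicator_one hs, ← integral_indicator_one hs,
    integral_map measurable_fst.aemeasurable
      (measurable_one.indicator hs).aestronglyMeasurable,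
    integral_gapLaw hg (C := 1)]
  · refine integral_congr_ae (Filter.Eventually.of_forall fun x => ?_)
    simp only
    ring
  · exact (measurable_one.indicator hs).comp measurable_fst
  · intro z
    by_cases h : z.1 ∈ s <;> simp [h]

lemma ae_gapLaw {d : ℕ} {g : Ctx d → ℝ} {P : Round d → Prop} (hP : MeasurableSet {z | P z})
    (h : ∀ x a, P (x, unitReward a)) : ∀ᵐ z ∂(gapLaw g), P z := by
  refine (withDensity_absolutelyContinuous _ _).ae_le ?_
  unfold nullLaw
  exact (Measure.ae_prod_iff_ae_ae hP).2
    (Filter.Eventually.of_forall fun x => ae_coin _ (h x true) (h x false))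

/-- The mean rewards of an instance with gap `g`. -/
noncomputable def gapMean {d : ℕ} (g : Ctx d → ℝ) (k : Arm) (x : Ctx d) : ℝ :=
  1 / 2 + (if k then 1 else -1) * g x / 2

lemma measurable_gapMean {d : ℕ} {g : Ctx d → ℝ} (hg : IsGap g) (k : Arm) :
    Measurable (gapMean g k) := by
  unfold gapMean
  have := hg.meas
  fun_prop

lemma abs_gapMean_le {d : ℕ} {g : Ctx d → ℝ} (hg : IsGap g) (k : Arm) (x : Ctx d) :
    |gapMean g k x| ≤ 1 := by
  have h := abs_le.1 (hg.bound x)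
  unfold gapMean
  cases k <;> simp only [Bool.false_eq_true, if_true, if_false] <;> rw [abs_le] <;>
    constructor <;> linarith

lemma condExp_gapLaw {d : ℕ} {g : Ctx d → ℝ} (hg : IsGap g) (k : Arm) :
    (gapLaw g)[(fun z : Round d => z.2 k) | MeasurableSpace.comap Prod.fst inferInstance]
      =ᵐ[gapLaw g] fun z => gapMean g k z.1 := by
  have := isProbabilityMeasure_gapLaw hg
  -- A clamped reward, almost surely equal to the true one, is bounded everywhere and hence
  -- integrable.
  set Y : Round d → ℝ := fun z => max (min (z.2 k) 1) 0 with hY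
  have hYm : Measurable Y := by fun_prop
  have hYb : ∀ z, |Y z| ≤ 1 := fun z =>
    abs_le.2 ⟨by linarith [le_max_right (min (z.2 k) 1) 0], max_le (min_le_right _ _) (by norm_num)⟩
  have hae : (fun z : Round d => z.2 k) =ᵐ[gapLaw g] Y := by
    refine ae_gapLaw (measurableSet_eq_fun (by fun_prop) hYm) fun x a => ?_
    simp only [hY, unitReward]
    split_ifs <;> norm_num
  have hmm : Measurable fun z : Round d => gapMean g k z.1 :=
    (measurable_gapMean hg k).comp measurable_fst
  refine (condExp_congr_ae hae).trans ?_
  refine (ae_eq_condExp_of_forall_setIntegral_eq measurable_fst.comap_le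
    (integrable_of_bound hYm hYb) (fun s _ _ => ?_) ?_ ?_).symm
  · exact (integrable_of_bound hmm fun z => abs_gapMean_le hg k z.1).integrableOn
  · rintro _ ⟨s, hs, rfl⟩ -
    have hs' : MeasurableSet (Prod.fst ⁻¹' s : Set (Round d)) := measurable_fst hs
    rw [← integral_indicator hs', ← integral_indicator hs',
      integral_gapLaw hg (hmm.indicator hs') (C := 1),
      integral_gapLaw hg (hYm.indicator hs') (C := 1)]
    · refine integral_congr_ae (Filter.Eventually.of_forall fun x => ?_)
      by_cases hx : x ∈ s
      · cases k <;> simp [Set.indicator, hx, hY, unitReward, gapMean] <;> ring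
      · simp [Set.indicator, hx]
    · exact fun z => (norm_indicator_le_norm_self (f := Y) (a := z)).trans (hYb z)
    · exact fun z => (norm_indicator_le_norm_self (f := fun z : Round d => gapMean g k z.1)
        (a := z)).trans (abs_gapMean_le hg k z.1)
  · refine StronglyMeasurable.aestronglyMeasurable ?_
    exact ((measurable_gapMean hg k).comp
      (comap_measurable (Prod.fst : Round d → Ctx d))).stronglyMeasurable

/-- The instance with gap `g` in which exactly one arm pays off in each round. -/
noncomputable def gapInstance {d : ℕ} (g : Ctx d → ℝ) (hg : IsGap g) : Instance d where
  law := gapLaw g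
  mean := gapMean g
  isProbabilityMeasure_law := isProbabilityMeasure_gapLaw hg
  reward_mem k := ae_gapLaw
    ((measurable_pi_apply k).comp measurable_snd measurableSet_Icc) fun x a => by
      simp only [unitReward]
      split_ifs <;> simp
  condExp_reward := condExp_gapLaw hg

/-- Each arm's mean moves by half the gap, so the gap itself may have Hölder constant `2 * L`. -/
lemma gapInstance_mem {d : ℕ} {g : Ctx d → ℝ} (hg : IsGap g) {α β L δ₀ D₀ : ℝ}
    (hS : ∀ x ∈ cube d, ∀ y ∈ cube d, |g x - g y| ≤ 2 * L * ‖x - y‖ ^ β)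
    (hM : ∀ δ : ℝ, 0 ≤ δ →
      (uniformCube d).real {x | 0 < |g x| ∧ |g x| ≤ δ} ≤ D₀ * δ ^ α) :
    gapInstance g hg ∈ instanceClass (uniformCube d) α β L δ₀ D₀ := by
  refine ⟨map_fst_gapLaw hg, ?_, ?_⟩
  · intro k x hx y hy
    have h : gapMean g k x - gapMean g k y = (if k then 1 else -1) * ((g x - g y) / 2) := by
      unfold gapMean; ring
    change |gapMean g k x - gapMean g k y| ≤ _
    rw [h, abs_mul, abs_div]
    have h1 : |(if k then 1 else -1 : ℝ)| = 1 := by cases k <;> simp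
    rw [h1, abs_two]
    linarith [hS x hx y hy]
  · intro δ hδ
    have h : ∀ x, (gapInstance g hg).mean true x - (gapInstance g hg).mean false x = g x := by
      intro x
      change gapMean g true x - gapMean g false x = g x
      simp [gapMean]
      ring
    simp only [h]
    exact hM δ hδ.1

/-! ### Densities and independence in product measures. -/

section ProductMeasures

variable {ι : Type*} [Fintype ι] {Z : ι → Type*} [∀ i, MeasurableSpace (Z i)]

lemma pi_withDensity (μ : ∀ i, Measure (Z i)) [∀ i, IsProbabilityMeasure (μ i)]
    {f : ∀ i, Z i → ENNReal} (hf : ∀ i, Measurable (f i))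
    [∀ i, IsProbabilityMeasure ((μ i).withDensity (f i))] :
    Measure.pi (fun i => (μ i).withDensity (f i))
      = (Measure.pi μ).withDensity fun ω => ∏ i, f i (ω i) := by
  refine (Measure.pi_eq fun s hs => ?_)
  have hm : MeasurableSet (Set.univ.pi s) := MeasurableSet.univ_pi hs
  rw [withDensity_apply _ hm, ← lintegral_indicator hm]
  have h1 : ∀ ω : ∀ i, Z i, (Set.univ.pi s).indicator (fun ω => ∏ i, f i (ω i)) ω
      = ∏ i, (s i).indicator (f i) (ω i) := by
    intro ω
    by_cases h : ω ∈ Set.univ.pi s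
    · rw [Set.indicator_of_mem h]
      exact Finset.prod_congr rfl fun i _ => (Set.indicator_of_mem (h i trivial) _).symm
    · rw [Set.indicator_of_notMem h]
      simp only [Set.mem_pi, Set.mem_univ, true_implies, not_forall] at h
      obtain ⟨i, hi⟩ := h
      exact (Finset.prod_eq_zero (Finset.mem_univ i) (Set.indicator_of_notMem hi _)).symm
  simp only [h1]
  have hmeas : ∀ i, Measurable ((s i).indicator (f i)) := fun i => (hf i).indicator (hs i)
  have h2 := ProbabilityTheory.lintegral_prod_eq_prod_lintegral_of_indepFun
    (μ := Measure.pi μ) Finset.univ (fun i (ω : ∀ i, Z i) => (s i).indicator (f i) (ω i))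
    (ProbabilityTheory.iIndepFun_pi fun i => (hmeas i).aemeasurable)
    (fun i => (hmeas i).comp (measurable_pi_apply i))
  rw [h2]
  refine Finset.prod_congr rfl fun i _ => ?_
  rw [withDensity_apply _ (hs i), ← lintegral_indicator (hs i)]
  exact (measurePreserving_eval μ i).lintegral_comp (hmeas i)

/-- `K` factors through the coordinates in `A`, the others being filled in from a fixed point, and
is therefore independent of coordinate `t`. -/
lemma integral_mul_of_dependsOn_compl [DecidableEq ι] (μ : ∀ i, Measure (Z i))
    [∀ i, IsProbabilityMeasure (μ i)] [∀ i, Nonempty (Z i)] (A : Finset ι) {t : ι} (ht : t ∉ A)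
    {φ : Z t → ℝ} (hφ : Measurable φ) {K : (∀ i, Z i) → ℝ} (hK : Measurable K)
    (hdep : ∀ ω ω' : ∀ i, Z i, (∀ i ∈ A, ω i = ω' i) → K ω = K ω') :
    ∫ ω, φ (ω t) * K ω ∂(Measure.pi μ) = (∫ z, φ z ∂(μ t)) * ∫ ω, K ω ∂(Measure.pi μ) := by
  obtain ⟨ω0⟩ : Nonempty (∀ i, Z i) := inferInstance
  set ext : (∀ i : A, Z i) → ∀ i, Z i := fun u i => if h : i ∈ A then u ⟨i, h⟩ else ω0 i with hext
  have hextm : Measurable ext := by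
    refine measurable_pi_lambda _ fun i => ?_
    by_cases h : i ∈ A
    · simpa [hext, h] using measurable_pi_apply (⟨i, h⟩ : A)
    · simp [hext, h]
  have hKK : K = (K ∘ ext) ∘ fun ω (i : A) => ω i := by
    funext ω
    exact hdep _ _ fun i hi => by simp [hext, hi]
  have hind : ProbabilityTheory.iIndepFun (fun i (ω : ∀ i, Z i) => ω i) (Measure.pi μ) :=
    ProbabilityTheory.iIndepFun_pi (X := fun i (z : Z i) => z) fun i => aemeasurable_id
  have h1 := (hind.indepFun_finset {t} A (by simpa using ht) fun i => measurable_pi_apply i).comp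
    (φ := fun u : (∀ i : ({t} : Finset ι), Z i) => φ (u ⟨t, by simp⟩)) (ψ := K ∘ ext)
    (hφ.comp (measurable_pi_apply _)) (hK.comp hextm)
  have h2 := h1.integral_fun_mul_eq_mul_integral
    ((hφ.comp (measurable_pi_apply t)).aestronglyMeasurable)
    ((hKK ▸ hK).aestronglyMeasurable)
  rw [← hKK] at h2
  refine h2.trans ?_
  congr 1
  have h3 := integral_map (μ := Measure.pi μ) (measurable_pi_apply t).aemeasurable
    (hφ.aestronglyMeasurable (μ := (Measure.pi μ).map (Function.eval t)))
  rw [(measurePreserving_eval μ t).map_eq] at h3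
  exact h3.symm

lemma integral_abs_le_sqrt {Ω : Type*} [MeasurableSpace Ω] {P : Measure Ω} [IsProbabilityMeasure P]
    {f : Ω → ℝ} (hf : MemLp f 2 P) : ∫ ω, |f ω| ∂P ≤ Real.sqrt (∫ ω, f ω ^ 2 ∂P) := by
  refine Real.le_sqrt_of_sq_le ?_
  have h := ProbabilityTheory.variance_nonneg |f| P
  rw [ProbabilityTheory.variance_eq_sub hf.abs] at h
  simpa using h

end ProductMeasures

/-! ### Change of measure over the first `n` rounds. -/

section Hybrid

variable {d T : ℕ}

/-- Forget the rewards of all rounds from round `n` on. -/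
def forget (n : ℕ) (ω : Fin T → Round d) : Fin T → Round d :=
  fun l => if (l : ℕ) < n then ω l else ((ω l).1, unitReward true)

lemma measurable_forgetRewards :
    Measurable fun z : Round d => (z.1, unitReward true) := by fun_prop

/-- The law of a round before time `n` with gap `g`, and of its context only afterwards. -/
noncomputable def hybridFactor (g : Ctx d → ℝ) (n l : ℕ) : Measure (Round d) :=
  if l < n then gapLaw g else (uniformCube d).map fun x => (x, unitReward true)

lemma isProbabilityMeasure_hybridFactor {g : Ctx d → ℝ} (hg : IsGap g) (n l : ℕ) :
    IsProbabilityMeasure (hybridFactor g n l) := by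
  unfold hybridFactor
  split_ifs
  · exact isProbabilityMeasure_gapLaw hg
  · exact Measure.isProbabilityMeasure_map (by fun_prop)

/-- Forgetting acts coordinatewise, so the image of the product law is again a product. Under it the
later rounds have the same law for all gaps, and only the first `n` rounds enter the likelihood
ratio. -/
lemma integral_hybrid {g : Ctx d → ℝ} (hg : IsGap g) (n : ℕ) {H : (Fin T → Round d) → ℝ}
    (hH : Measurable H) (hdep : ∀ ω, H (forget n ω) = H ω) :
    ∫ ω, H ω ∂(Measure.pi fun _ : Fin T => gapLaw g)
      = ∫ ω, H ω ∂(Measure.pi fun l : Fin T => hybridFactor g n l) := by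
  have := isProbabilityMeasure_gapLaw hg
  have := isProbabilityMeasure_hybridFactor hg
  have hf : ∀ l : Fin T, Measurable
      (fun z : Round d => if (l : ℕ) < n then z else (z.1, unitReward true)) := by
    intro l
    split_ifs
    · exact measurable_id
    · exact measurable_forgetRewards
  have h1 : (Measure.pi fun _ : Fin T => gapLaw g).map (forget n)
      = Measure.pi fun l : Fin T => hybridFactor g n l := by
    have h2 : ∀ l : Fin T, (gapLaw g).map
        (fun z : Round d => if (l : ℕ) < n then z else (z.1, unitReward true))
        = hybridFactor g n l := by
      intro l
      unfold hybridFactor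
      split_ifs
      · exact Measure.map_id
      · rw [← map_fst_gapLaw hg, Measure.map_map (by fun_prop) measurable_fst]
        rfl
    have h3 : ∀ l : Fin T, SigmaFinite ((gapLaw g).map
        (fun z : Round d => if (l : ℕ) < n then z else (z.1, unitReward true))) := by
      intro l
      rw [h2]
      infer_instance
    have := Measure.pi_map_pi (μ := fun _ : Fin T => gapLaw g)
      (f := fun (l : Fin T) (z : Round d) => if (l : ℕ) < n then z else (z.1, unitReward true))
      fun l => (hf l).aemeasurable
    simp only [h2] at this
    exact this
  rw [← h1, integral_map]
  · simp only [hdep]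
  · exact (measurable_pi_lambda _ fun l => (hf l).comp (measurable_pi_apply l)).aemeasurable
  · exact hH.aestronglyMeasurable

/-- The likelihood ratio of one round of the hybrid laws. -/
noncomputable def ratioFactor (g₀ g₁ : Ctx d → ℝ) (n l : ℕ) (z : Round d) : ℝ :=
  if l < n then gapDensity g₁ z / gapDensity g₀ z else 1

variable {g₀ g₁ : Ctx d → ℝ}

lemma measurable_ratioFactor (h₀ : IsGap g₀) (h₁ : IsGap g₁) (n l : ℕ) :
    Measurable (ratioFactor g₀ g₁ n l) := by
  unfold ratioFactor
  split_ifs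
  · exact (measurable_gapDensity h₁).div (measurable_gapDensity h₀)
  · exact measurable_const

lemma ratioFactor_bounds (h₀ : IsGap g₀) (h₁ : IsGap g₁) (n l : ℕ) (z : Round d) :
    0 ≤ ratioFactor g₀ g₁ n l z ∧ ratioFactor g₀ g₁ n l z ≤ 3 := by
  have b0 := gapDensity_bounds h₀ z
  have b1 := gapDensity_bounds h₁ z
  unfold ratioFactor
  split_ifs
  · exact ⟨div_nonneg (by linarith) (by linarith),
      (div_le_iff₀ (by linarith)).2 (by linarith)⟩
  · norm_num

lemma withDensity_ratioFactor (h₀ : IsGap g₀) (h₁ : IsGap g₁) (n l : ℕ) :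
    (hybridFactor g₀ n l).withDensity (fun z => ENNReal.ofReal (ratioFactor g₀ g₁ n l z))
      = hybridFactor g₁ n l := by
  unfold hybridFactor ratioFactor
  split_ifs
  · unfold gapLaw
    have hm : Measurable fun z => ENNReal.ofReal (gapDensity g₁ z / gapDensity g₀ z) :=
      ((measurable_gapDensity h₁).div (measurable_gapDensity h₀)).ennreal_ofReal
    rw [← withDensity_mul _ (measurable_gapDensity h₀).ennreal_ofReal hm]
    congr 1
    funext z
    have b0 := gapDensity_bounds h₀ z
    rw [Pi.mul_apply, ← ENNReal.ofReal_mul (by linarith), mul_div_cancel₀ _ (by linarith)]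
  · simp

lemma integral_ratioFactor (h₀ : IsGap g₀) (h₁ : IsGap g₁) (n l : ℕ) :
    ∫ z, ratioFactor g₀ g₁ n l z ∂(hybridFactor g₀ n l) = 1 := by
  have := isProbabilityMeasure_hybridFactor h₁ n l
  have h := integral_withDensity_eq_integral_toReal_smul (μ := hybridFactor g₀ n l)
    (measurable_ratioFactor h₀ h₁ n l).ennreal_ofReal
    (Filter.Eventually.of_forall fun _ => by simp) (fun _ => (1 : ℝ))
  rw [withDensity_ratioFactor h₀ h₁] at h
  simp only [integral_const, probReal_univ, smul_eq_mul, mul_one] at h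
  rw [h]
  refine integral_congr_ae (Filter.Eventually.of_forall fun z => ?_)
  simp only
  rw [ENNReal.toReal_ofReal (ratioFactor_bounds h₀ h₁ n l z).1]

/-- The squared distance of two gaps, which bounds the information about them in one round. -/
noncomputable def gapDist (g₀ g₁ : Ctx d → ℝ) : ℝ := ∫ x, (g₁ x - g₀ x) ^ 2 ∂(uniformCube d)

lemma gapDist_nonneg (g₀ g₁ : Ctx d → ℝ) : 0 ≤ gapDist g₀ g₁ :=
  integral_nonneg fun _ => sq_nonneg _

/-- This is a chi-square computation: averaging over the two outcomes gives `1 + (g₁ - g₀)² / (1 -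
g₀²)` at each context, and `|g₀| ≤ 1 / 2` keeps the denominator above `1 / 2`. -/
lemma integral_ratioFactor_sq_le (h₀ : IsGap g₀) (h₁ : IsGap g₁) {n l : ℕ} (hl : l < n) :
    ∫ z, ratioFactor g₀ g₁ n l z ^ 2 ∂(hybridFactor g₀ n l) ≤ 1 + 2 * gapDist g₀ g₁ := by
  have hb := ratioFactor_bounds h₀ h₁ n l
  have m0 := h₀.meas
  have m1 := h₁.meas
  have hi : Integrable (fun x => (g₁ x - g₀ x) ^ 2) (uniformCube d) := by
    refine integrable_of_bound (by fun_prop) (C := 1) fun x => ?_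
    have a0 := abs_le.1 (h₀.bound x)
    have a1 := abs_le.1 (h₁.bound x)
    rw [abs_of_nonneg (sq_nonneg _)]
    nlinarith
  have hH : hybridFactor g₀ n l = gapLaw g₀ := if_pos hl
  rw [hH, integral_gapLaw h₀ ((measurable_ratioFactor h₀ h₁ n l).pow_const 2) (C := 9)]
  · have : 1 + 2 * gapDist g₀ g₁
        = ∫ x, 1 + 2 * (g₁ x - g₀ x) ^ 2 ∂(uniformCube d) := by
      rw [integral_add (integrable_const _) (hi.const_mul _), integral_const_mul]
      simp [gapDist]
    rw [this]
    refine integral_mono_of_nonneg (Filter.Eventually.of_forall fun x => ?_) ?_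
      (Filter.Eventually.of_forall fun x => ?_)
    · have a0 := abs_le.1 (h₀.bound x)
      have := mul_nonneg (show 0 ≤ 1 + g₀ x by linarith)
        (sq_nonneg (ratioFactor g₀ g₁ n l (x, unitReward true)))
      have := mul_nonneg (show 0 ≤ 1 - g₀ x by linarith)
        (sq_nonneg (ratioFactor g₀ g₁ n l (x, unitReward false)))
      simp only [Pi.zero_apply]
      linarith
    · exact (integrable_const (1 : ℝ)).add (hi.const_mul 2)
    · have a0 := abs_le.1 (h₀.bound x)
      have p : 0 < 1 + g₀ x := by linarith
      have q : 0 < 1 - g₀ x := by linarith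
      simp only [ratioFactor, if_pos hl, gapDensity_unitReward]
      have e1 : (1 + g₀ x) * ((1 + g₁ x) / (1 + g₀ x)) ^ 2 = (1 + g₁ x) ^ 2 / (1 + g₀ x) := by
        field_simp
      have e2 : (1 - g₀ x) * ((1 - g₁ x) / (1 - g₀ x)) ^ 2 = (1 - g₁ x) ^ 2 / (1 - g₀ x) := by
        field_simp
      have e3 : ((1 + g₁ x) ^ 2 / (1 + g₀ x) + (1 - g₁ x) ^ 2 / (1 - g₀ x)) / 2
          = 1 + (g₁ x - g₀ x) ^ 2 / ((1 + g₀ x) * (1 - g₀ x)) := by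
        field_simp
        ring
      rw [e1, e2, e3]
      have e4 : (g₁ x - g₀ x) ^ 2 / ((1 + g₀ x) * (1 - g₀ x)) ≤ 2 * (g₁ x - g₀ x) ^ 2 := by
        rw [div_le_iff₀ (mul_pos p q)]
        have : (1 : ℝ) / 2 ≤ (1 + g₀ x) * (1 - g₀ x) := by nlinarith
        nlinarith [mul_le_mul_of_nonneg_left this (sq_nonneg (g₁ x - g₀ x))]
      linarith
  · intro z
    rw [abs_of_nonneg (sq_nonneg _)]
    nlinarith [(hb z).1, (hb z).2]

/-- By independence the second moment of the likelihood ratio is at most `(1 + χ) ^ n ≤ exp (n * χ)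
≤ 1 + 2 * n * χ` when `n * χ ≤ 1`; Cauchy-Schwarz turns this into an `L¹` bound. -/
lemma integral_abs_ratio_sub_one_le (h₀ : IsGap g₀) (h₁ : IsGap g₁) (n : ℕ)
    (hn : n * (2 * gapDist g₀ g₁) ≤ 1) :
    ∫ ω, |∏ l : Fin T, ratioFactor g₀ g₁ n l (ω l) - 1|
        ∂(Measure.pi fun l : Fin T => hybridFactor g₀ n l)
      ≤ Real.sqrt (4 * (n * gapDist g₀ g₁)) := by
  have := isProbabilityMeasure_hybridFactor h₀
  set P := Measure.pi fun l : Fin T => hybridFactor g₀ n l with hP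
  set R : (Fin T → Round d) → ℝ := fun ω => ∏ l : Fin T, ratioFactor g₀ g₁ n l (ω l) with hR
  have hRm : Measurable R := Finset.measurable_prod _ fun l _ =>
    (measurable_ratioFactor h₀ h₁ n l).comp (measurable_pi_apply l)
  have hRb : ∀ ω, |R ω| ≤ 3 ^ T := by
    intro ω
    rw [hR, Finset.abs_prod]
    calc _ ≤ ∏ _l : Fin T, (3 : ℝ) := Finset.prod_le_prod (fun _ _ => abs_nonneg _) fun l _ => by
          rw [abs_of_nonneg (ratioFactor_bounds h₀ h₁ n l _).1]
          exact (ratioFactor_bounds h₀ h₁ n l _).2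
      _ = _ := by simp
  have hRL : MemLp R 2 P := MemLp.of_bound hRm.aestronglyMeasurable _
    (Filter.Eventually.of_forall hRb)
  have hR1 : ∫ ω, R ω ∂P = 1 := by
    rw [hR, hP, integral_fintype_prod_eq_prod (𝕜 := ℝ) fun (l : Fin T) => ratioFactor g₀ g₁ n l]
    exact Finset.prod_eq_one fun l _ => integral_ratioFactor h₀ h₁ n l
  set χ := 2 * gapDist g₀ g₁ with hχ
  have hχ0 : 0 ≤ χ := mul_nonneg two_pos.le (gapDist_nonneg _ _)
  have hR2 : ∫ ω, R ω ^ 2 ∂P ≤ (1 + χ) ^ n := by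
    have : ∀ ω, R ω ^ 2 = ∏ l : Fin T, ratioFactor g₀ g₁ n l (ω l) ^ 2 := fun ω => by
      rw [hR, Finset.prod_pow]
    simp only [this]
    rw [hP, integral_fintype_prod_eq_prod (𝕜 := ℝ)
      fun (l : Fin T) z => ratioFactor g₀ g₁ n l z ^ 2]
    calc _ ≤ ∏ l : Fin T, (if (l : ℕ) < n then 1 + χ else 1) := by
          refine Finset.prod_le_prod (fun l _ => integral_nonneg fun _ => sq_nonneg _) fun l _ => ?_
          split_ifs with hl
          · exact integral_ratioFactor_sq_le h₀ h₁ hl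
          · simp [ratioFactor, hl]
      _ = (1 + χ) ^ (Finset.univ.filter fun l : Fin T => (l : ℕ) < n).card := by
          rw [Finset.prod_ite]
          simp
      _ ≤ _ := by
          refine pow_le_pow_right₀ (by linarith) ?_
          calc _ = ((Finset.univ.filter fun l : Fin T => (l : ℕ) < n).image Fin.val).card :=
                (Finset.card_image_of_injective _ Fin.val_injective).symm
            _ ≤ (Finset.range n).card := Finset.card_le_card fun i hi => by
                simp only [Finset.mem_image, Finset.mem_filter, Finset.mem_univ, true_and] at hi
                obtain ⟨l, hl, rfl⟩ := hi
                exact Finset.mem_range.2 hl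
            _ = n := Finset.card_range n
  have hpow : (1 + χ) ^ n ≤ 1 + 2 * (n * χ) := by
    have h1 : (1 + χ) ^ n ≤ Real.exp (n * χ) := by
      rw [Real.exp_nat_mul]
      exact pow_le_pow_left₀ (by linarith) (by linarith [Real.add_one_le_exp χ]) n
    have h2 := Real.abs_exp_sub_one_le (x := n * χ) (by rwa [abs_of_nonneg (by positivity)])
    rw [abs_of_nonneg (show 0 ≤ n * χ by positivity)] at h2
    linarith [le_abs_self (Real.exp (n * χ) - 1)]
  refine (integral_abs_le_sqrt (hRL.sub (memLp_const 1))).trans (Real.sqrt_le_sqrt ?_)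
  have hi1 : Integrable (fun ω => R ω ^ 2) P := hRL.integrable_sq
  have hi2 : Integrable R P := hRL.integrable (by norm_num)
  have : ∫ ω, (R ω - 1) ^ 2 ∂P = ∫ ω, R ω ^ 2 ∂P - 1 := by
    have : ∀ ω, (R ω - 1) ^ 2 = R ω ^ 2 - (2 * R ω - 1) := fun ω => by ring
    simp only [this]
    have hi3 : Integrable (fun ω => 2 * R ω - 1) P := (hi2.const_mul 2).sub (integrable_const 1)
    rw [integral_sub hi1 hi3,
      integral_sub (hi2.const_mul 2) (integrable_const 1), integral_const_mul, hR1]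
    simp
    norm_num
  change ∫ ω, (R ω - 1) ^ 2 ∂P ≤ _
  rw [this]
  calc _ ≤ 2 * (n * χ) := by linarith
    _ = _ := by rw [hχ]; ring

/-- Testing lower bound: a test `H` that uses the rewards of the first `n` rounds only cannot tell
gap `g₁` from gap `g₀`, even if it is weighted by a function of a later context. -/
lemma integral_test_le (h₀ : IsGap g₀) (h₁ : IsGap g₁) (n : ℕ)
    (hn : n * (2 * gapDist g₀ g₁) ≤ 1) {φ : Ctx d → ℝ} (hφ : Measurable φ) (hφ0 : ∀ x, 0 ≤ φ x)
    (hφ1 : ∀ x, φ x ≤ 1) {t : Fin T} (ht : n ≤ t) {H : (Fin T → Round d) → ℝ} (hH : Measurable H)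
    (hH0 : ∀ ω, 0 ≤ H ω) (hH1 : ∀ ω, H ω ≤ 1) (hdep : ∀ ω, H (forget n ω) = H ω) :
    ∫ ω, φ (ω t).1 * H ω ∂(Measure.pi fun _ : Fin T => gapLaw g₀)
        - (∫ x, φ x ∂(uniformCube d)) * Real.sqrt (4 * (n * gapDist g₀ g₁))
      ≤ ∫ ω, φ (ω t).1 * H ω ∂(Measure.pi fun _ : Fin T => gapLaw g₁) := by
  have := isProbabilityMeasure_hybridFactor h₀
  have := isProbabilityMeasure_hybridFactor h₁
  have hφt : Measurable fun ω : Fin T → Round d => φ (ω t).1 := by fun_prop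
  have hdep' : ∀ ω : Fin T → Round d,
      φ (forget n ω t).1 * H (forget n ω) = φ (ω t).1 * H ω := by
    intro ω
    rw [hdep]
    congr 2
    unfold forget
    split_ifs <;> rfl
  have hm : Measurable fun ω : Fin T → Round d => φ (ω t).1 * H ω := hφt.mul hH
  rw [integral_hybrid h₀ n hm hdep', integral_hybrid h₁ n hm hdep']
  set P := Measure.pi fun l : Fin T => hybridFactor g₀ n l with hP
  set R : (Fin T → Round d) → ℝ := fun ω => ∏ l : Fin T, ratioFactor g₀ g₁ n l (ω l) with hR
  have hRm : Measurable R := Finset.measurable_prod _ fun l _ =>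
    (measurable_ratioFactor h₀ h₁ n l).comp (measurable_pi_apply l)
  have hR0 : ∀ ω, 0 ≤ R ω := fun ω =>
    Finset.prod_nonneg fun l _ => (ratioFactor_bounds h₀ h₁ n l _).1
  have hRb : ∀ ω, R ω ≤ 3 ^ T := by
    intro ω
    calc _ ≤ ∏ _l : Fin T, (3 : ℝ) := Finset.prod_le_prod
          (fun l _ => (ratioFactor_bounds h₀ h₁ n l _).1) fun l _ =>
          (ratioFactor_bounds h₀ h₁ n l _).2
      _ = _ := by simp
  have hdens : (Measure.pi fun l : Fin T => hybridFactor g₁ n l)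
      = P.withDensity fun ω => ENNReal.ofReal (R ω) := by
    have hw := fun l : Fin T => withDensity_ratioFactor h₀ h₁ n l
    have : ∀ l : Fin T, IsProbabilityMeasure ((hybridFactor g₀ n l).withDensity
        fun z => ENNReal.ofReal (ratioFactor g₀ g₁ n l z)) := fun l => by
      rw [hw]; infer_instance
    have h := pi_withDensity (fun l : Fin T => hybridFactor g₀ n l)
      (f := fun (l : Fin T) z => ENNReal.ofReal (ratioFactor g₀ g₁ n l z))
      fun l => (measurable_ratioFactor h₀ h₁ n l).ennreal_ofReal
    simp only [hw] at h
    rw [h]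
    congr 1
    funext ω
    exact (ENNReal.ofReal_prod_of_nonneg (f := fun l : Fin T => ratioFactor g₀ g₁ n l (ω l))
      fun l _ => (ratioFactor_bounds h₀ h₁ n l _).1).symm
  rw [hdens, integral_withDensity_eq_integral_toReal_smul hRm.ennreal_ofReal
    (Filter.Eventually.of_forall fun _ => by simp)]
  -- The ratio involves only rounds before `n ≤ t`, so the weight of the context in round `t`
  -- factors out. The testing error is thus multiplied by the mass of `φ`, without which small bumps
  -- would be drowned.
  have h3 : (∫ x, φ x ∂(uniformCube d)) * Real.sqrt (4 * (n * gapDist g₀ g₁))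
      ≥ ∫ ω, φ (ω t).1 * |R ω - 1| ∂P := by
    have e := integral_mul_of_dependsOn_compl (fun l : Fin T => hybridFactor g₀ n l)
      (Finset.univ.filter fun l : Fin T => (l : ℕ) < n) (t := t) (by simpa using ht)
      (hφ.comp measurable_fst) (K := fun ω => |R ω - 1|) (by fun_prop) ?_
    · have e2 : ∫ z, (φ ∘ Prod.fst) z ∂(hybridFactor g₀ n t) = ∫ x, φ x ∂(uniformCube d) := by
        unfold hybridFactor
        rw [if_neg (by omega), integral_map (by fun_prop)
          (hφ.comp measurable_fst).aestronglyMeasurable]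
        rfl
      rw [e2] at e
      change ∫ ω, φ (ω t).1 * |R ω - 1| ∂P = _ at e
      rw [e]
      exact mul_le_mul_of_nonneg_left (integral_abs_ratio_sub_one_le h₀ h₁ n hn)
        (integral_nonneg hφ0)
    · intro ω ω' h
      simp only [Finset.mem_filter, Finset.mem_univ, true_and] at h
      have : R ω = R ω' := Finset.prod_congr rfl fun l _ => by
        by_cases hl : (l : ℕ) < n
        · rw [h l hl]
        · simp [ratioFactor, hl]
      simp only [this]
  have hb : ∀ ω, |φ (ω t).1 * H ω| ≤ 1 := fun ω => by
    rw [abs_of_nonneg (mul_nonneg (hφ0 _) (hH0 _))]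
    exact mul_le_one₀ (hφ1 _) (hH0 _) (hH1 _)
  have hi1 : Integrable (fun ω => φ (ω t).1 * H ω) P := integrable_of_bound (hφt.mul hH) hb
  have hRn : ∀ ω, |R ω - 1| ≤ 3 ^ T + 1 := fun ω =>
    abs_le.2 ⟨by linarith [hR0 ω, hRb ω], by linarith [hRb ω]⟩
  have hi2 : Integrable (fun ω => φ (ω t).1 * |R ω - 1|) P := by
    refine integrable_of_bound (by fun_prop) (C := 1 * (3 ^ T + 1)) fun ω => ?_
    rw [abs_mul, abs_abs]
    refine mul_le_mul ?_ (hRn ω) (abs_nonneg _) zero_le_one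
    rw [abs_of_nonneg (hφ0 _)]
    exact hφ1 _
  have hi3 : Integrable (fun ω => (ENNReal.ofReal (R ω)).toReal • (φ (ω t).1 * H ω)) P := by
    refine integrable_of_bound (by fun_prop) (C := 3 ^ T * 1) fun ω => ?_
    rw [smul_eq_mul, ENNReal.toReal_ofReal (hR0 ω), abs_mul, abs_of_nonneg (hR0 ω)]
    exact mul_le_mul (hRb ω) (hb ω) (abs_nonneg _) (by positivity)
  have h4 : ∫ ω, φ (ω t).1 * H ω ∂P - ∫ ω, φ (ω t).1 * |R ω - 1| ∂P
      ≤ ∫ ω, (ENNReal.ofReal (R ω)).toReal • (φ (ω t).1 * H ω) ∂P := by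
    rw [← integral_sub hi1 hi2]
    refine integral_mono (hi1.sub hi2) hi3 fun ω => ?_
    simp only [smul_eq_mul, ENNReal.toReal_ofReal (hR0 ω)]
    have a1 : φ (ω t).1 * (H ω * (1 - R ω)) ≤ φ (ω t).1 * |R ω - 1| := by
      refine mul_le_mul_of_nonneg_left ?_ (hφ0 _)
      calc H ω * (1 - R ω) ≤ H ω * |R ω - 1| := by
            refine mul_le_mul_of_nonneg_left ?_ (hH0 _)
            rw [abs_sub_comm]; exact le_abs_self _
        _ ≤ 1 * |R ω - 1| := mul_le_mul_of_nonneg_right (hH1 _) (abs_nonneg _)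
        _ = _ := one_mul _
    nlinarith
  linarith

end Hybrid

/-! ### What a policy can know within a batch. -/

section Policy

variable {d T M : ℕ} {S : Type*} [MeasurableSpace S]

/-- Samples that agree in whole rounds could differ in what is observed only if the actions
differed. Induction over the batches excludes this, since the actions in a batch are determined by
earlier observations and the contexts. -/
lemma BatchPolicy.grid_action_congr (p : BatchPolicy d T M S) (s : S) {ω ω' : Fin T → Round d}
    {n : ℕ} (h : ∀ l : Fin T, (l : ℕ) < n → ω l = ω' l) :
    ∀ i ≤ M, p.grid i (s, ω) ≤ n → p.grid i (s, ω') = p.grid i (s, ω) ∧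
      SameObs p.action (p.grid i (s, ω)) (s, ω) (s, ω') := by
  intro i
  induction i with
  | zero =>
    intro _ _
    simp only [p.grid_zero]
    exact ⟨trivial, rfl, fun l hl => absurd hl (Nat.not_lt_zero _)⟩
  | succ i ih =>
    intro hi hn
    have hlt := p.grid_lt i (by omega) (s, ω)
    obtain ⟨-, hs⟩ := ih (by omega) (by omega)
    refine ⟨(p.grid_adapted i (by omega) _ _ hs).symm, rfl, fun l hl => ?_⟩
    by_cases hli : (l : ℕ) < p.grid i (s, ω)
    · exact hs.2 l hli
    · have ha := p.action_adapted i (by omega) l (s, ω) (s, ω') (by omega) hl hs fun l' hl' => by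
        have : (l' : ℕ) ≤ l := hl'
        simp only [h l' (by omega)]
      have := h l (by omega)
      simp only [this, ha, and_self]

lemma BatchPolicy.sameObs (p : BatchPolicy d T M S) (s : S) {ω ω' : Fin T → Round d} {n i : ℕ}
    (hi : i ≤ M) (h : ∀ l : Fin T, (l : ℕ) < n → ω l = ω' l) (hn : p.grid i (s, ω) ≤ n) :
    SameObs p.action (p.grid i (s, ω)) (s, ω) (s, ω') :=
  (p.grid_action_congr s h i hi hn).2

/-- The event that batch `i` starts at time `a` or earlier and ends at time `b` or later. -/
def BatchPolicy.batchEvent (p : BatchPolicy d T M S) (s : S) (i a b : ℕ) :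
    Set (Fin T → Round d) :=
  {ω | p.grid i (s, ω) ≤ a ∧ b ≤ p.grid (i + 1) (s, ω)}

lemma BatchPolicy.measurableSet_batchEvent (p : BatchPolicy d T M S) (s : S) {i : ℕ} (hi : i < M)
    (a b : ℕ) : MeasurableSet (p.batchEvent s i a b) := by
  have h1 : Measurable fun ω => p.grid i (s, ω) :=
    (p.measurable_grid i hi.le).comp measurable_prodMk_left
  have h2 : Measurable fun ω => p.grid (i + 1) (s, ω) :=
    (p.measurable_grid (i + 1) hi).comp measurable_prodMk_left
  exact (measurableSet_le h1 measurable_const).inter (measurableSet_le measurable_const h2)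

/-- The end of batch `i` is already fixed at its start, so even for an adaptive grid the event is
decided by the rounds before `a`. -/
lemma BatchPolicy.batchEvent_congr (p : BatchPolicy d T M S) (s : S) {i a b : ℕ} (hi : i < M)
    {ω ω' : Fin T → Round d} (h : ∀ l : Fin T, (l : ℕ) < a → ω l = ω' l)
    (hω : ω ∈ p.batchEvent s i a b) : ω' ∈ p.batchEvent s i a b := by
  refine ⟨?_, ?_⟩
  · rw [(p.grid_action_congr s h i hi.le hω.1).1]; exact hω.1
  · rw [← p.grid_adapted i hi _ _ (p.sameObs s hi.le h hω.1)]; exact hω.2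

lemma BatchPolicy.batchEvent_iff (p : BatchPolicy d T M S) (s : S) {i a b : ℕ} (hi : i < M)
    {ω ω' : Fin T → Round d} (h : ∀ l : Fin T, (l : ℕ) < a → ω l = ω' l) :
    ω ∈ p.batchEvent s i a b ↔ ω' ∈ p.batchEvent s i a b :=
  ⟨p.batchEvent_congr s hi h, p.batchEvent_congr s hi fun l hl => (h l hl).symm⟩

lemma BatchPolicy.action_congr (p : BatchPolicy d T M S) (s : S) {i a b : ℕ} (hi : i < M)
    {ω ω' : Fin T → Round d} (h : ∀ l : Fin T, (l : ℕ) < a → ω l = ω' l)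
    (hX : ∀ l, (ω l).1 = (ω' l).1) (hω : ω ∈ p.batchEvent s i a b) {t : Fin T} (ha : a ≤ t)
    (hb : (t : ℕ) < b) : p.action t (s, ω) = p.action t (s, ω') :=
  p.action_adapted i hi t _ _ (hω.1.trans ha) (hb.trans_le hω.2)
    (p.sameObs s hi.le h hω.1)
    fun l _ => hX l

/-- If no batch jumped over its window, `t_i ≤ a i` would propagate from `t_0 = 0` to `t_M = T`,
against `a M < T`. The `+ 1` makes the window include the round with index `a (i + 1)`. -/
lemma BatchPolicy.exists_batchEvent (p : BatchPolicy d T M S) (s : S) {a : ℕ → ℕ} (h0 : a 0 = 0)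
    (hM : a M < T) (ω : Fin T → Round d) :
    ∃ i < M, ω ∈ p.batchEvent s i (a i) (a (i + 1) + 1) := by
  by_contra! hne
  have : ∀ i ≤ M, p.grid i (s, ω) ≤ a i := by
    intro i
    induction i with
    | zero => intro _; rw [p.grid_zero, h0]
    | succ i ih =>
      intro hi
      by_contra! hlt
      exact hne i hi ⟨ih (by omega), hlt⟩
  have h := this M le_rfl
  rw [p.grid_last] at h
  omega

/-- Indicator of pulling arm `c` in round `t` within a batch that covers the rounds from `a`
to `b`. -/
noncomputable def BatchPolicy.pullIn (p : BatchPolicy d T M S) (s : S) (i a b : ℕ) (t : Fin T)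
    (c : Arm) : (Fin T → Round d) → ℝ :=
  (p.batchEvent s i a b ∩ {ω | p.action t (s, ω) = c}).indicator 1

lemma BatchPolicy.measurable_action_seed (p : BatchPolicy d T M S) (s : S) (t : Fin T) :
    Measurable fun ω => p.action t (s, ω) :=
  (p.measurable_action t).comp measurable_prodMk_left

lemma BatchPolicy.measurable_pullIn (p : BatchPolicy d T M S) (s : S) {i : ℕ} (hi : i < M)
    (a b : ℕ) (t : Fin T) (c : Arm) : Measurable (p.pullIn s i a b t c) :=
  measurable_one.indicator ((p.measurableSet_batchEvent s hi a b).inter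
    (p.measurable_action_seed s t (measurableSet_singleton c)))

lemma BatchPolicy.pullIn_nonneg (p : BatchPolicy d T M S) (s : S) (i a b : ℕ) (t : Fin T)
    (c : Arm) (ω : Fin T → Round d) : 0 ≤ p.pullIn s i a b t c ω :=
  Set.indicator_nonneg (fun _ _ => zero_le_one) _

lemma BatchPolicy.pullIn_le_one (p : BatchPolicy d T M S) (s : S) (i a b : ℕ) (t : Fin T)
    (c : Arm) (ω : Fin T → Round d) : p.pullIn s i a b t c ω ≤ 1 :=
  Set.indicator_le_self' (fun _ _ => zero_le_one) _

lemma BatchPolicy.pullIn_forget (p : BatchPolicy d T M S) (s : S) {i a b : ℕ} (hi : i < M)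
    {t : Fin T} (ha : a ≤ t) (hb : (t : ℕ) < b) (c : Arm) (ω : Fin T → Round d) :
    p.pullIn s i a b t c (forget a ω) = p.pullIn s i a b t c ω := by
  have h : ∀ l : Fin T, (l : ℕ) < a → ω l = forget a ω l := fun l hl => by simp [forget, hl]
  have hX : ∀ l, (ω l).1 = (forget a ω l).1 := fun l => by unfold forget; split_ifs <;> rfl
  unfold BatchPolicy.pullIn
  simp only [Set.indicator, Set.mem_inter_iff, Set.mem_ofPred_eq]
  have hiff := p.batchEvent_iff s (b := b) hi h
  by_cases hω : ω ∈ p.batchEvent s i a b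
  · have hact := p.action_congr s hi h hX hω ha hb
    simp only [Set.mem_inter_iff, hω, hiff.1 hω, true_and, Set.mem_ofPred_eq, hact, Pi.one_apply]
  · simp [hω, mt hiff.2 hω]

/-- The expected `φ`-weight of pulling arm `c` in round `t` within a batch from `a` to `b`, under
gap `g`. -/
noncomputable def BatchPolicy.pullWeight (p : BatchPolicy d T M S) (s : S) (i a b : ℕ) (t : Fin T)
    (c : Arm) (φ g : Ctx d → ℝ) : ℝ :=
  ∫ ω, φ (ω t).1 * p.pullIn s i a b t c ω ∂(Measure.pi fun _ : Fin T => gapLaw g)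

/-- The probability that batch `i` covers the rounds from `a` to `b`. -/
noncomputable def BatchPolicy.batchProb (p : BatchPolicy d T M S) (s : S) (i a b : ℕ)
    (g : Ctx d → ℝ) : ℝ :=
  (Measure.pi fun _ : Fin T => gapLaw g).real (p.batchEvent s i a b)

/-- One of the two arms is pulled, and the batch event, decided before `a ≤ t`, is independent of
the context in round `t`. -/
lemma BatchPolicy.pullWeight_add (p : BatchPolicy d T M S) (s : S) {i a b : ℕ} (hi : i < M)
    {t : Fin T} (ha : a ≤ t) {φ g : Ctx d → ℝ} (hg : IsGap g) (hφ : Measurable φ)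
    (hφ0 : ∀ x, 0 ≤ φ x) (hφ1 : ∀ x, φ x ≤ 1) :
    p.pullWeight s i a b t false φ g + p.pullWeight s i a b t true φ g
      = (∫ x, φ x ∂(uniformCube d)) * p.batchProb s i a b g := by
  have := isProbabilityMeasure_gapLaw hg
  have hφt : Measurable fun ω : Fin T → Round d => φ (ω t).1 := by fun_prop
  have hint : ∀ c, Integrable (fun ω => φ (ω t).1 * p.pullIn s i a b t c ω)
      (Measure.pi fun _ : Fin T => gapLaw g) := fun c => by
    refine integrable_of_bound (hφt.mul (p.measurable_pullIn s hi a b t c)) (C := 1) fun ω => ?_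
    rw [abs_of_nonneg (mul_nonneg (hφ0 _) (p.pullIn_nonneg ..))]
    exact mul_le_one₀ (hφ1 _) (p.pullIn_nonneg ..) (p.pullIn_le_one ..)
  unfold BatchPolicy.pullWeight BatchPolicy.batchProb
  rw [← integral_add (hint false) (hint true)]
  have hE := p.measurableSet_batchEvent s hi a b
  have h1 := integral_mul_of_dependsOn_compl (fun _ : Fin T => gapLaw g)
    (Finset.univ.filter fun l : Fin T => (l : ℕ) < a) (t := t) (by simpa using ha)
    (hφ.comp measurable_fst) (K := (p.batchEvent s i a b).indicator 1)
    (measurable_one.indicator hE) ?_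
  · rw [integral_indicator_one hE] at h1
    have h2 : ∫ z, (φ ∘ Prod.fst) z ∂(gapLaw g) = ∫ x, φ x ∂(uniformCube d) := by
      rw [← map_fst_gapLaw hg, integral_map measurable_fst.aemeasurable
        hφ.aestronglyMeasurable]
      rfl
    rw [h2] at h1
    rw [← h1]
    refine integral_congr_ae (Filter.Eventually.of_forall fun ω => ?_)
    simp only [BatchPolicy.pullIn, Function.comp_apply, ← mul_add]
    congr 1
    by_cases hω : ω ∈ p.batchEvent s i a b
    · cases hact : p.action t (s, ω) <;> simp [Set.indicator, hω, hact]
    · simp [Set.indicator, hω]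
  · intro ω ω' h
    simp only [Finset.mem_filter, Finset.mem_univ, true_and] at h
    have hiff := p.batchEvent_iff s (b := b) hi h
    by_cases hω : ω ∈ p.batchEvent s i a b
    · simp [hω, hiff.1 hω]
    · simp [hω, mt hiff.2 hω]

/-- Two instances close to a reference instance cannot both be served well by the same policy. -/
lemma BatchPolicy.le_pullWeight_add (p : BatchPolicy d T M S) (s : S) {i a b : ℕ} (hi : i < M)
    {t : Fin T} (ha : a ≤ t) (hb : (t : ℕ) < b) {φ g₀ g₁ g₂ : Ctx d → ℝ} (h₀ : IsGap g₀)
    (h₁ : IsGap g₁) (h₂ : IsGap g₂) (hφ : Measurable φ) (hφ0 : ∀ x, 0 ≤ φ x)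
    (hφ1 : ∀ x, φ x ≤ 1) {η : ℝ} (hη0 : 0 ≤ η) (hη1 : η ≤ 1)
    (hd1 : 4 * (a * gapDist g₀ g₁) ≤ η ^ 2) (hd2 : 4 * (a * gapDist g₀ g₂) ≤ η ^ 2) :
    (∫ x, φ x ∂(uniformCube d)) * (p.batchProb s i a b g₀ - 2 * η)
      ≤ p.pullWeight s i a b t false φ g₁ + p.pullWeight s i a b t true φ g₂ := by
  have hw : 0 ≤ ∫ x, φ x ∂(uniformCube d) := integral_nonneg hφ0
  have key : ∀ (c : Arm) (g : Ctx d → ℝ), IsGap g → 4 * (a * gapDist g₀ g) ≤ η ^ 2 →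
      p.pullWeight s i a b t c φ g₀ - (∫ x, φ x ∂(uniformCube d)) * η
        ≤ p.pullWeight s i a b t c φ g := by
    intro c g hg hd
    have hnn : 0 ≤ a * gapDist g₀ g := mul_nonneg (Nat.cast_nonneg a) (gapDist_nonneg _ _)
    have h := integral_test_le h₀ hg a (by nlinarith) hφ hφ0 hφ1 ha
      (p.measurable_pullIn s hi a b t c) (fun _ => p.pullIn_nonneg ..)
      (fun _ => p.pullIn_le_one ..)
      (p.pullIn_forget s hi ha hb c)
    have h2 : Real.sqrt (4 * (a * gapDist g₀ g)) ≤ η := Real.sqrt_le_iff.2 ⟨hη0, hd⟩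
    have h3 := mul_le_mul_of_nonneg_left h2 hw
    unfold BatchPolicy.pullWeight
    linarith
  have e := p.pullWeight_add s hi ha (b := b) h₀ hφ hφ0 hφ1
  have k1 := key false g₁ h₁ hd1
  have k2 := key true g₂ h₂ hd2
  linarith

/-- Some batch is likely to cover its target window. -/
lemma BatchPolicy.one_le_sum_batchProb (p : BatchPolicy d T M S) (s : S) {a : ℕ → ℕ}
    (h0 : a 0 = 0) (hM : a M < T) {g : Ctx d → ℝ} (hg : IsGap g) :
    1 ≤ ∑ i ∈ Finset.range M, p.batchProb s i (a i) (a (i + 1) + 1) g := by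
  have := isProbabilityMeasure_gapLaw hg
  set P := Measure.pi fun _ : Fin T => gapLaw g
  have h1 : (⋃ i ∈ Finset.range M, p.batchEvent s i (a i) (a (i + 1) + 1)) = Set.univ := by
    refine Set.eq_univ_of_forall fun ω => ?_
    obtain ⟨i, hi, h⟩ := p.exists_batchEvent s h0 hM ω
    simp only [Set.mem_iUnion, Finset.mem_range]
    exact ⟨i, hi, h⟩
  calc (1 : ℝ) = P.real (⋃ i ∈ Finset.range M, p.batchEvent s i (a i) (a (i + 1) + 1)) := by
        rw [h1]; simp
    _ ≤ _ := measureReal_biUnion_finset_le _ _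

end Policy

/-! ### Gaps made of disjoint signed bumps. -/

section Bumps

variable {d : ℕ} {ι : Type*} [Fintype ι]

/-- A finite family of bumps with disjoint supports. -/
structure IsBumpFamily (φ : ι → Ctx d → ℝ) : Prop where
  meas : ∀ i, Measurable (φ i)
  nonneg : ∀ i x, 0 ≤ φ i x
  le_half : ∀ i x, φ i x ≤ 1 / 2
  disj : ∀ i j x, φ i x ≠ 0 → φ j x ≠ 0 → i = j

/-- The sign of an arm. -/
def armSign (c : Arm) : ℝ := if c then 1 else -1

/-- The gap given by signed bumps. -/
noncomputable def bumpGap (φ : ι → Ctx d → ℝ) (σ : ι → Arm) (x : Ctx d) : ℝ :=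
  ∑ i, armSign (σ i) * φ i x

lemma IsBumpFamily.eq_single_or_zero {φ : ι → Ctx d → ℝ} (hφ : IsBumpFamily φ) (x : Ctx d) :
    (∀ i, φ i x = 0) ∨ ∃ i, ∀ j, j ≠ i → φ j x = 0 := by
  by_cases h : ∀ i, φ i x = 0
  · exact Or.inl h
  · push Not at h
    obtain ⟨i, hi⟩ := h
    exact Or.inr ⟨i, fun j hj => by_contra fun hne => hj (hφ.disj j i x hne hi)⟩

lemma IsBumpFamily.isGap {φ : ι → Ctx d → ℝ} (hφ : IsBumpFamily φ) (σ : ι → Arm) :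
    IsGap (bumpGap φ σ) where
  meas := by
    unfold bumpGap
    exact Finset.measurable_sum _ fun i _ => (hφ.meas i).const_mul _
  bound x := by
    unfold bumpGap
    rcases hφ.eq_single_or_zero x with h | ⟨i, h⟩
    · simp [h]
    · rw [Finset.sum_eq_single i (fun j _ hj => by rw [h j hj, mul_zero]) (by simp), abs_mul,
        abs_of_nonneg (hφ.nonneg i x)]
      have : |armSign (σ i)| = 1 := by unfold armSign; split_ifs <;> simp
      rw [this, one_mul]
      exact hφ.le_half i x

/-- The loss of the wrong arm is `|g|`, and at most one bump is alive at `x`; hence the regret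
splits into one nonnegative term per bump. -/
lemma IsBumpFamily.regret_eq {φ : ι → Ctx d → ℝ} (hφ : IsBumpFamily φ) (σ : ι → Arm) (c : Arm)
    (x : Ctx d) :
    max (gapMean (bumpGap φ σ) true x) (gapMean (bumpGap φ σ) false x) - gapMean (bumpGap φ σ) c x
      = ∑ i, φ i x * (if c = !σ i then 1 else 0) := by
  have h0 : max (gapMean (bumpGap φ σ) true x) (gapMean (bumpGap φ σ) false x)
      = 1 / 2 + |bumpGap φ σ x| / 2 := by
    unfold gapMean
    rcases abs_cases (bumpGap φ σ x) with ⟨h, h'⟩ | ⟨h, h'⟩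
    · rw [h, max_eq_left] <;> simp <;> linarith
    · rw [h, max_eq_right] <;> simp <;> linarith
  rw [h0]
  unfold gapMean bumpGap
  rcases hφ.eq_single_or_zero x with h | ⟨i, h⟩
  · simp [h]
  · rw [Finset.sum_eq_single i (fun j _ hj => by rw [h j hj, mul_zero]) (by simp),
      Finset.sum_eq_single i (fun j _ hj => by rw [h j hj, zero_mul]) (by simp), abs_mul,
      abs_of_nonneg (hφ.nonneg i x)]
    cases c <;> cases σ i <;> simp [armSign] <;> ring

end Bumps

/-! ### Averaging over finitely many instances and over the seed. -/

section SeedRegret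

variable {d T M : ℕ} {S : Type*} [MeasurableSpace S]

/-- The regret, under gap `g`, of a policy whose seed is known. -/
noncomputable def BatchPolicy.seedRegret (p : BatchPolicy d T M S) (s : S) (g : Ctx d → ℝ) : ℝ :=
  ∫ ω, ∑ t : Fin T, (max (gapMean g true (ω t).1) (gapMean g false (ω t).1)
    - gapMean g (p.action t (s, ω)) (ω t).1) ∂(Measure.pi fun _ : Fin T => gapLaw g)

lemma measurable_gapMean_action {Ω : Type*} [MeasurableSpace Ω] {g : Ctx d → ℝ} (hg : IsGap g)
    {c : Ω → Arm} (hc : Measurable c) {X : Ω → Ctx d} (hX : Measurable X) :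
    Measurable fun ω => gapMean g (c ω) (X ω) := by
  have : (fun ω => gapMean g (c ω) (X ω)) = fun ω =>
      if c ω = true then gapMean g true (X ω) else gapMean g false (X ω) := by
    funext ω
    cases c ω <;> rfl
  rw [this]
  exact Measurable.ite (hc (measurableSet_singleton true)) ((measurable_gapMean hg _).comp hX)
    ((measurable_gapMean hg _).comp hX)

/-- The worst instance is at least as bad as the average one. The hypothesis is needed seed by seed
only, so everything that follows may treat the policy as deterministic. -/
lemma exists_le_regret (ν : Measure S) [IsProbabilityMeasure ν] (p : BatchPolicy d T M S)
    {κ : Type*} [Fintype κ] [Nonempty κ] {g : κ → Ctx d → ℝ} (hg : ∀ k, IsGap (g k)) {B : ℝ}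
    (hB : ∀ s, Fintype.card κ * B ≤ ∑ k, p.seedRegret s (g k)) :
    ∃ k, B ≤ regret ν p (gapInstance (g k) (hg k)) := by
  have key : ∀ k, Integrable (fun s => p.seedRegret s (g k)) ν ∧
      regret ν p (gapInstance (g k) (hg k)) = ∫ s, p.seedRegret s (g k) ∂ν := by
    intro k
    have := isProbabilityMeasure_gapLaw (hg k)
    have hint : Integrable (fun ω : Sample d T S => ∑ t : Fin T,
        (max (gapMean (g k) true (ω.2 t).1) (gapMean (g k) false (ω.2 t).1)
          - gapMean (g k) (p.action t ω) (ω.2 t).1))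
        (ν.prod (Measure.pi fun _ : Fin T => gapLaw (g k))) := by
      refine integrable_of_bound (C := ∑ _t : Fin T, 2) ?_ fun ω => ?_
      · refine Finset.measurable_sum _ fun t _ => ?_
        have hX : Measurable fun ω : Sample d T S => (ω.2 t).1 := by fun_prop
        exact (((measurable_gapMean (hg k) _).comp hX).max
          ((measurable_gapMean (hg k) _).comp hX)).sub
          (measurable_gapMean_action (hg k) (p.measurable_action t) hX)
      · refine (Finset.abs_sum_le_sum_abs _ _).trans (Finset.sum_le_sum fun t _ => ?_)
        have h := fun c => abs_le.1 (abs_gapMean_le (hg k) c (ω.2 t).1)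
        have h1 := h (p.action t ω)
        have h2 := (h true).1.trans (le_max_left _ (gapMean (g k) false (ω.2 t).1))
        have h3 := max_le (h true).2 (h false).2
        exact abs_le.2 ⟨by linarith, by linarith⟩
    refine ⟨hint.integral_prod_left, ?_⟩
    change ∫ ω, _ ∂(ν.prod (Measure.pi fun _ : Fin T => gapLaw (g k))) = _
    exact integral_prod _ hint
  by_contra! hlt
  have h1 : ∑ k, regret ν p (gapInstance (g k) (hg k)) < ∑ _k : κ, B :=
    Finset.sum_lt_sum_of_nonempty Finset.univ_nonempty fun k _ => hlt k
  have h2 : ∫ _s, Fintype.card κ * B ∂ν ≤ ∫ s, ∑ k, p.seedRegret s (g k) ∂ν :=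
    integral_mono (integrable_const _) (integrable_finsetSum _ fun k _ => (key k).1) hB
  rw [integral_finsetSum _ fun k _ => (key k).1] at h2
  simp only [← fun k => (key k).2] at h2
  simp only [integral_const, probReal_univ, one_smul, Finset.sum_const, Finset.card_univ,
    nsmul_eq_mul] at h1 h2
  linarith

/-- All contributions to the regret are nonnegative, so those outside the chosen rounds, bumps and
batch event can be dropped. -/
lemma BatchPolicy.sum_pullWeight_le_seedRegret (p : BatchPolicy d T M S) (s : S) {i a b : ℕ}
    (hi : i < M) {ι : Type*} [Fintype ι] {φ : ι → Ctx d → ℝ} (hφ : IsBumpFamily φ) (σ : ι → Arm)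
    (W : Finset (Fin T)) (B : Finset ι) :
    ∑ t ∈ W, ∑ k ∈ B, p.pullWeight s i a b t (!σ k) (φ k) (bumpGap φ σ)
      ≤ p.seedRegret s (bumpGap φ σ) := by
  have := isProbabilityMeasure_gapLaw (hφ.isGap σ)
  unfold BatchPolicy.seedRegret BatchPolicy.pullWeight
  simp only [hφ.regret_eq]
  set P := Measure.pi fun _ : Fin T => gapLaw (bumpGap φ σ)
  have hφt : ∀ (t : Fin T) k, Measurable fun ω : Fin T → Round d => φ k (ω t).1 := fun t k =>
    (hφ.meas k).comp (by fun_prop)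
  have hbd : ∀ (t : Fin T) k (h : (Fin T → Round d) → ℝ), Measurable h → (∀ ω, 0 ≤ h ω) →
      (∀ ω, h ω ≤ 1) → Integrable (fun ω => φ k (ω t).1 * h ω) P := by
    intro t k h hm h0 h1
    refine integrable_of_bound ((hφt t k).mul hm) (C := 1) fun ω => ?_
    rw [abs_of_nonneg (mul_nonneg (hφ.nonneg _ _) (h0 _))]
    exact mul_le_one₀ ((hφ.le_half _ _).trans (by norm_num)) (h0 _) (h1 _)
  have hi1 : ∀ t k, Integrable
      (fun ω => φ k (ω t).1 * p.pullIn s i a b t (!σ k) ω) P := fun t k =>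
    hbd t k _ (p.measurable_pullIn s hi a b t _) (fun _ => p.pullIn_nonneg ..)
      (fun _ => p.pullIn_le_one ..)
  have hi2 : ∀ t k, Integrable
      (fun ω => φ k (ω t).1 * (if p.action t (s, ω) = !σ k then 1 else 0)) P := fun t k =>
    hbd t k _ (Measurable.ite (p.measurable_action_seed s t (measurableSet_singleton _))
      measurable_const measurable_const) (fun ω => by split_ifs <;> norm_num)
      (fun ω => by split_ifs <;> norm_num)
  have e : ∑ t ∈ W, ∑ k ∈ B, ∫ ω, φ k (ω t).1 * p.pullIn s i a b t (!σ k) ω ∂P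
      = ∫ ω, ∑ t ∈ W, ∑ k ∈ B, φ k (ω t).1 * p.pullIn s i a b t (!σ k) ω ∂P := by
    rw [integral_finsetSum _ fun t _ => integrable_finsetSum _ fun k _ => hi1 t k]
    exact Finset.sum_congr rfl fun t _ => (integral_finsetSum _ fun k _ => hi1 t k).symm
  rw [e]
  refine integral_mono (integrable_finsetSum _ fun t _ => integrable_finsetSum _ fun k _ => hi1 t k)
    (integrable_finsetSum _ fun t _ => integrable_finsetSum _ fun k _ => hi2 t k) fun ω => ?_
  have h0 : ∀ t k, 0 ≤ φ k (ω t).1 * (if p.action t (s, ω) = !σ k then (1 : ℝ) else 0) :=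
    fun t k => mul_nonneg (hφ.nonneg _ _) (by split_ifs <;> norm_num)
  calc ∑ t ∈ W, ∑ k ∈ B, φ k (ω t).1 * p.pullIn s i a b t (!σ k) ω
      ≤ ∑ t ∈ W, ∑ k ∈ B, φ k (ω t).1 * (if p.action t (s, ω) = !σ k then 1 else 0) := by
        refine Finset.sum_le_sum fun t _ => Finset.sum_le_sum fun k _ =>
          mul_le_mul_of_nonneg_left ?_ (hφ.nonneg _ _)
        unfold BatchPolicy.pullIn
        by_cases h : p.action t (s, ω) = !σ k
        · rw [if_pos h]; exact Set.indicator_le_self' (fun _ _ => zero_le_one) _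
        · rw [if_neg h, Set.indicator_of_notMem fun hm => h hm.2]
    _ ≤ ∑ t ∈ W, ∑ k, φ k (ω t).1 * (if p.action t (s, ω) = !σ k then 1 else 0) :=
        Finset.sum_le_sum fun t _ => Finset.sum_le_sum_of_subset_of_nonneg
          (Finset.subset_univ _) fun k _ _ => h0 t k
    _ ≤ _ := Finset.sum_le_sum_of_subset_of_nonneg (Finset.subset_univ _) fun t _ _ =>
          Finset.sum_nonneg fun k _ => h0 t k

end SeedRegret

/-! ### Bayes regret under the two priors. -/

section Priors

variable {d T M : ℕ} {S : Type*} [MeasurableSpace S]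

lemma card_window {a b : ℕ} (hab : a ≤ b) (hb : b ≤ T) :
    ((Finset.univ.filter fun t : Fin T => a ≤ (t : ℕ) ∧ (t : ℕ) < b).card : ℝ) = b - a := by
  have h : (Finset.univ.filter fun t : Fin T => a ≤ (t : ℕ) ∧ (t : ℕ) < b).map Fin.valEmbedding
      = Finset.Ico a b := by
    ext i
    simp only [Finset.mem_map, Finset.mem_filter, Finset.mem_univ, true_and, Finset.mem_Ico,
      Fin.valEmbedding_apply]
    exact ⟨fun ⟨t, ht, e⟩ => e ▸ ht, fun hi => ⟨⟨i, by omega⟩, hi, rfl⟩⟩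
  rw [← Finset.card_map Fin.valEmbedding, h, Nat.card_Ico, Nat.cast_sub hab]

lemma bumpGap_update {ι : Type*} [Fintype ι] [DecidableEq ι] (φ : ι → Ctx d → ℝ) (σ : ι → Arm)
    (k : ι) (c : Arm) (x : Ctx d) :
    bumpGap φ (Function.update σ k c) x - bumpGap φ σ x
      = (armSign c - armSign (σ k)) * φ k x := by
  unfold bumpGap
  rw [← Finset.sum_sub_distrib, Finset.sum_eq_single k]
  · simp only [Function.update_self]; ring
  · intro j _ hj
    rw [Function.update_of_ne hj, sub_self]
  · simp

lemma gapDist_update {ι : Type*} [Fintype ι] [DecidableEq ι] (φ : ι → Ctx d → ℝ) (σ : ι → Arm)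
    (k : ι) :
    gapDist (bumpGap φ σ) (bumpGap φ (Function.update σ k (!σ k)))
      = 4 * ∫ x, φ k x ^ 2 ∂(uniformCube d) := by
  unfold gapDist
  rw [← integral_const_mul]
  refine integral_congr_ae (Filter.Eventually.of_forall fun x => ?_)
  simp only [bumpGap_update]
  cases σ k <;> simp [armSign] <;> ring

lemma gapDist_self (g : Ctx d → ℝ) : gapDist g g = 0 := by simp [gapDist]

/-- Lower bound for the Bayes regret under random signs of bumps of several scales, in which the
batch `i` cannot cope with the bumps of the scale `B i`. -/
lemma exists_le_regret_of_bumps (ν : Measure S) [IsProbabilityMeasure ν] (p : BatchPolicy d T M S)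
    (hM1 : 1 ≤ M) {ι : Type*} [Fintype ι] {φ : ι → Ctx d → ℝ} (hφ : IsBumpFamily φ) {a : ℕ → ℕ}
    (h0 : a 0 = 0) (ha : ∀ i, i < M → a i ≤ a (i + 1) ∧ a (i + 1) < T) (B : ℕ → Finset ι)
    (hinfo : ∀ i < M, ∀ k ∈ B i,
      16 * (a i * ∫ x, φ k x ^ 2 ∂(uniformCube d)) ≤ (1 / (4 * (M : ℝ))) ^ 2) {b : ℝ}
    (hb : ∀ i < M, b ≤ ((a (i + 1) : ℝ) + 1 - a i) *
      (∑ k ∈ B i, ∫ x, φ k x ∂(uniformCube d)) * (1 / (4 * (M : ℝ)))) :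
    ∃ σ, b ≤ regret ν p (gapInstance (bumpGap φ σ) (hφ.isGap σ)) := by
  classical
  have hM0 : (0 : ℝ) < M := by exact_mod_cast hM1
  have haM : a M < T := by
    have := (ha (M - 1) (by omega)).2
    rwa [Nat.sub_add_cancel hM1] at this
  refine exists_le_regret ν p (fun σ => hφ.isGap σ) fun s => ?_
  -- Two comparisons cost `2 * η`, which is half of the average batch probability `1 / M`.
  set η : ℝ := 1 / (4 * M) with hη
  have hη0 : 0 < η := by positivity
  have hη1 : η ≤ 1 := by
    rw [hη, div_le_one (by positivity)]
    have : (1 : ℝ) ≤ M := by exact_mod_cast hM1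
    linarith
  set N : ℝ := (Fintype.card (ι → Arm) : ℝ) with hN
  have hsum : ∑ _i ∈ Finset.range M, N / M ≤ ∑ i ∈ Finset.range M, ∑ σ : ι → Arm,
      p.batchProb s i (a i) (a (i + 1) + 1) (bumpGap φ σ) := by
    rw [Finset.sum_comm]
    calc ∑ _i ∈ Finset.range M, N / M = ∑ _σ : ι → Arm, (1 : ℝ) := by
          simp [hN]
          field_simp
      _ ≤ _ := Finset.sum_le_sum fun σ _ => p.one_le_sum_batchProb s h0 haM (hφ.isGap σ)
  -- The batch `i` depends on the seed; this is harmless because `hb` gives the same bound for every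
  -- `i`.
  obtain ⟨i, hi, hP⟩ := Finset.exists_le_of_sum_le (by simpa using by omega) hsum
  rw [Finset.mem_range] at hi
  set P : (ι → Arm) → ℝ := fun σ => p.batchProb s i (a i) (a (i + 1) + 1) (bumpGap φ σ) with hPdef
  set W := Finset.univ.filter fun t : Fin T => a i ≤ (t : ℕ) ∧ (t : ℕ) < a (i + 1) + 1 with hW
  set w : ι → ℝ := fun k => ∫ x, φ k x ∂(uniformCube d) with hw
  have hw0 : ∀ k, 0 ≤ w k := fun k => integral_nonneg (hφ.nonneg k)
  set F : Fin T → ι → (ι → Arm) → ℝ := fun t k σ =>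
    p.pullWeight s i (a i) (a (i + 1) + 1) t (!σ k) (φ k) (bumpGap φ σ) with hF
  -- The reference gap is `bumpGap φ σ` itself, at distance zero from one member of the pair; the
  -- other member flips the sign of bump `k`. The wrong arm for one member is the right arm for the
  -- other.
  have hpair : ∀ t ∈ W, ∀ k ∈ B i, ∀ σ : ι → Arm,
      w k * (P σ - 2 * η) ≤ F t k σ + F t k (Function.update σ k (!σ k)) := by
    intro t ht k hk σ
    simp only [hW, Finset.mem_filter, Finset.mem_univ, true_and] at ht
    have hd1 : 4 * ((a i : ℝ) * gapDist (bumpGap φ σ) (bumpGap φ σ)) ≤ η ^ 2 := by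
      rw [gapDist_self]
      simpa using sq_nonneg η
    have hd2 : 4 * ((a i : ℝ) *
        gapDist (bumpGap φ σ) (bumpGap φ (Function.update σ k (!σ k)))) ≤ η ^ 2 := by
      rw [gapDist_update]
      linarith [hinfo i hi k hk]
    have h1 := fun x => (hφ.le_half k x).trans (by norm_num : (1 : ℝ) / 2 ≤ 1)
    cases hσ : σ k
    · rw [hσ] at hd2
      have h := p.le_pullWeight_add s hi ht.1 ht.2 (hφ.isGap σ)
        (hφ.isGap (Function.update σ k (!false))) (hφ.isGap σ) (hφ.meas k) (hφ.nonneg k) h1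
        hη0.le hη1 hd2 hd1
      simp only [hF, hσ, Function.update_self, Bool.not_not]
      rw [add_comm]
      exact h
    · rw [hσ] at hd2
      have h := p.le_pullWeight_add s hi ht.1 ht.2 (hφ.isGap σ) (hφ.isGap σ)
        (hφ.isGap (Function.update σ k (!true))) (hφ.meas k) (hφ.nonneg k) h1
        hη0.le hη1 hd1 hd2
      simp only [hF, hσ, Function.update_self, Bool.not_not]
      exact h
  -- Flipping one sign permutes the sign vectors, so both members of a pair contribute the same
  -- total.
  have hflip : ∀ t k, ∑ σ, F t k (Function.update σ k (!σ k)) = ∑ σ, F t k σ := by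
    intro t k
    have hinv : Function.Involutive fun σ : ι → Arm => Function.update σ k (!σ k) := by
      intro σ
      simp
    exact Equiv.sum_comp hinv.toPerm (F t k)
  have hone : ∀ t ∈ W, ∀ k ∈ B i, w k * (N / (4 * M)) ≤ ∑ σ, F t k σ := by
    intro t ht k hk
    have h := Finset.sum_le_sum fun σ (_ : σ ∈ Finset.univ) => hpair t ht k hk σ
    rw [Finset.sum_add_distrib, hflip, ← Finset.mul_sum, Finset.sum_sub_distrib] at h
    simp only [Finset.sum_const, Finset.card_univ, nsmul_eq_mul] at h
    change w k * (∑ σ, P σ - N * (2 * η)) ≤ _ at h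
    have h2 : N / (2 * M) ≤ ∑ σ, P σ - N * (2 * η) := by
      have e : N / (2 * M) = N / M - N * (2 * η) := by
        rw [hη]; field_simp; ring
      rw [e]
      linarith
    have h3 := mul_le_mul_of_nonneg_left h2 (hw0 k)
    have h4 : w k * (N / (4 * M)) = w k * (N / (2 * M)) / 2 := by field_simp; ring
    linarith
  have hcard : (W.card : ℝ) = (a (i + 1) : ℝ) + 1 - a i := by
    rw [hW, card_window (by have := ha i hi; omega) (by have := ha i hi; omega)]
    push_cast
    ring
  calc N * b ≤ N * (((a (i + 1) : ℝ) + 1 - a i) * (∑ k ∈ B i, w k) * (1 / (4 * (M : ℝ)))) :=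
        mul_le_mul_of_nonneg_left (hb i hi) (by positivity)
    _ = ∑ _t ∈ W, ∑ k ∈ B i, w k * (N / (4 * M)) := by
        rw [Finset.sum_const, nsmul_eq_mul, hcard, ← Finset.sum_mul]
        ring
    _ ≤ ∑ t ∈ W, ∑ k ∈ B i, ∑ σ, F t k σ :=
        Finset.sum_le_sum fun t ht => Finset.sum_le_sum fun k hk => hone t ht k hk
    _ = ∑ σ, ∑ t ∈ W, ∑ k ∈ B i, F t k σ :=
        (Finset.sum_congr rfl fun t _ => Finset.sum_comm).trans Finset.sum_comm
    _ ≤ _ := Finset.sum_le_sum fun σ _ =>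
        p.sum_pullWeight_le_seedRegret s hi hφ σ W (B i)

/-- Lower bound for the Bayes regret when the gap is a single signed bump of a random scale. -/
lemma exists_le_regret_of_single_bump (ν : Measure S) [IsProbabilityMeasure ν]
    (p : BatchPolicy d T M S) (hM1 : 1 ≤ M) {φ : ℕ → Unit → Ctx d → ℝ}
    (hφ : ∀ i, IsBumpFamily (φ i)) {a : ℕ → ℕ}
    (h0 : a 0 = 0) (ha : ∀ i, i < M → a i ≤ a (i + 1) ∧ a (i + 1) < T)
    (hinfo : ∀ i < M,
      4 * (a i * ∫ x, φ i () x ^ 2 ∂(uniformCube d)) ≤ (1 / (4 * (M : ℝ))) ^ 2) {b : ℝ}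
    (hb : ∀ i < M, b ≤ ((a (i + 1) : ℝ) + 1 - a i) *
      (∫ x, φ i () x ∂(uniformCube d)) * (1 / (4 * (M : ℝ) ^ 2))) :
    ∃ i < M, ∃ c : Arm, b ≤ regret ν p
      (gapInstance (bumpGap (φ i) fun _ => c) ((hφ i).isGap fun _ => c)) := by
  have hM0 : (0 : ℝ) < M := by exact_mod_cast hM1
  have haM : a M < T := by
    have := (ha (M - 1) (by omega)).2
    rwa [Nat.sub_add_cancel hM1] at this
  have : Nonempty (Fin M) := ⟨⟨0, hM1⟩⟩
  suffices h : ∃ k : Fin M × Arm, b ≤ regret ν p (gapInstance (bumpGap (φ k.1) fun _ => k.2)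
      ((hφ k.1).isGap fun _ => k.2)) by
    obtain ⟨⟨i, c⟩, h⟩ := h
    exact ⟨i, i.2, c, h⟩
  refine exists_le_regret ν p (fun k : Fin M × Arm => (hφ k.1).isGap fun _ => k.2) fun s => ?_
  set η : ℝ := 1 / (4 * M) with hη
  have hη0 : 0 < η := by positivity
  have hη1 : η ≤ 1 := by
    rw [hη, div_le_one (by positivity)]
    have : (1 : ℝ) ≤ M := by exact_mod_cast hM1
    linarith
  have hnull : IsGap (fun _ : Ctx d => (0 : ℝ)) := ⟨measurable_const, fun _ => by norm_num⟩
  have hsum : ∑ _i ∈ Finset.range M, 1 / (M : ℝ) ≤ ∑ i ∈ Finset.range M,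
      p.batchProb s i (a i) (a (i + 1) + 1) fun _ => 0 := by
    refine le_trans (le_of_eq ?_) (p.one_le_sum_batchProb s h0 haM hnull)
    simp
    field_simp
  obtain ⟨i, hi, hP⟩ := Finset.exists_le_of_sum_le (by simpa using by omega) hsum
  rw [Finset.mem_range] at hi
  set W := Finset.univ.filter fun t : Fin T => a i ≤ (t : ℕ) ∧ (t : ℕ) < a (i + 1) + 1 with hW
  set w : ℝ := ∫ x, φ i () x ∂(uniformCube d) with hw
  have hw0 : 0 ≤ w := integral_nonneg ((hφ i).nonneg ())
  have hd : ∀ c : Arm, gapDist (fun _ : Ctx d => (0 : ℝ)) (bumpGap (φ i) fun _ => c)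
      = ∫ x, φ i () x ^ 2 ∂(uniformCube d) := by
    intro c
    unfold gapDist bumpGap armSign
    cases c <;> simp
  have hone : ∀ t ∈ W, w * (1 / (2 * M)) ≤ ∑ c : Arm,
      p.pullWeight s i (a i) (a (i + 1) + 1) t (!c) (φ i ()) (bumpGap (φ i) fun _ => c) := by
    intro t ht
    simp only [hW, Finset.mem_filter, Finset.mem_univ, true_and] at ht
    have hd' : ∀ c : Arm, 4 * ((a i : ℝ) * gapDist (fun _ : Ctx d => (0 : ℝ))
        (bumpGap (φ i) fun _ => c)) ≤ η ^ 2 := fun c => by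
      rw [hd]; exact hinfo i hi
    have h := p.le_pullWeight_add s hi ht.1 ht.2 hnull ((hφ i).isGap fun _ => true)
        ((hφ i).isGap fun _ => false) ((hφ i).meas ()) ((hφ i).nonneg ())
        (fun x => ((hφ i).le_half () x).trans (by norm_num)) hη0.le hη1 (hd' true) (hd' false)
    rw [Fintype.sum_bool]
    refine le_trans (mul_le_mul_of_nonneg_left ?_ hw0) h
    have e : 1 / (2 * (M : ℝ)) = 1 / M - 2 * η := by
      rw [hη]; field_simp; ring
    rw [e]
    linarith
  have hcard : (W.card : ℝ) = (a (i + 1) : ℝ) + 1 - a i := by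
    rw [hW, card_window (by have := ha i hi; omega) (by have := ha i hi; omega)]
    push_cast
    ring
  -- With empty sets of rounds and bumps the lower bound is the empty sum.
  have hnonneg : ∀ k : Fin M × Arm, 0 ≤ p.seedRegret s (bumpGap (φ k.1) fun _ => k.2) := fun k =>
    le_trans (by simp) (p.sum_pullWeight_le_seedRegret s hi (a := 0) (b := 0) (hφ k.1)
      (fun _ => k.2) ∅ ∅)
  have hle : ∀ j : Fin M, ∑ c : Arm, p.seedRegret s (bumpGap (φ j) fun _ => c)
      ≤ ∑ j : Fin M, ∑ c : Arm, p.seedRegret s (bumpGap (φ j) fun _ => c) := fun j =>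
    Finset.single_le_sum (f := fun j : Fin M =>
      ∑ c : Arm, p.seedRegret s (bumpGap (φ j) fun _ => c))
      (fun j _ => Finset.sum_nonneg fun c _ => hnonneg (j, c)) (Finset.mem_univ j)
  have hκ : (Fintype.card (Fin M × Arm) : ℝ) = M * 2 := by
    rw [Fintype.card_prod, Fintype.card_fin, Fintype.card_bool]
    push_cast
    rfl
  rw [hκ, Fintype.sum_prod_type]
  calc (M * 2 : ℝ) * b
      ≤ (M * 2 : ℝ) *
          (((a (i + 1) : ℝ) + 1 - a i) * w * (1 / (4 * (M : ℝ) ^ 2))) :=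
        mul_le_mul_of_nonneg_left (hb i hi) (by positivity)
    _ = ∑ _t ∈ W, w * (1 / (2 * M)) := by
        rw [Finset.sum_const, nsmul_eq_mul, hcard]
        field_simp
        norm_num
        ring
    _ ≤ ∑ t ∈ W, ∑ c : Arm,
          p.pullWeight s i (a i) (a (i + 1) + 1) t (!c) (φ i ()) (bumpGap (φ i) fun _ => c) :=
        Finset.sum_le_sum hone
    _ = ∑ c : Arm, ∑ t ∈ W, ∑ k ∈ Finset.univ,
          p.pullWeight s i (a i) (a (i + 1) + 1) t (!c) (φ i k) (bumpGap (φ i) fun _ => c) := by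
        rw [Finset.sum_comm]
        simp only [Finset.univ_unique, Finset.sum_singleton]
    _ ≤ ∑ c : Arm, p.seedRegret s (bumpGap (φ i) fun _ => c) := Finset.sum_le_sum fun c _ =>
        p.sum_pullWeight_le_seedRegret s hi (hφ i) (fun _ => c) W Finset.univ
    -- Only the scale of the bad batch is kept; this loses the extra factor `M` in `hb` compared
    -- with the prior on all scales at once.
    _ ≤ ∑ j : Fin M, ∑ c : Arm, p.seedRegret s (bumpGap (φ j) fun _ => c) :=
        hle ⟨i, hi⟩

end Priors

/-! ### Size, mass and level sets of one bump. -/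

section Bump

variable {d : ℕ}

/-- The bump of radius `r` centred at `z`, with Hölder exponent `β` and Hölder constant `C`. -/
noncomputable def bump (C β r : ℝ) (z x : Ctx d) : ℝ := C * max (r - ‖x - z‖) 0 ^ β

/-- Subadditivity of `u ↦ u ^ β` for `β ≤ 1`. -/
lemma abs_rpow_sub_rpow_le {u v β : ℝ} (hu : 0 ≤ u) (hv : 0 ≤ v) (hβ : 0 ≤ β) (hβ1 : β ≤ 1) :
    |u ^ β - v ^ β| ≤ |u - v| ^ β := by
  wlog h : v ≤ u generalizing u v
  · rw [abs_sub_comm, abs_sub_comm u v]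
    exact this hv hu (le_of_not_ge h)
  have h1 := Real.rpow_add_le_add_rpow (sub_nonneg.2 h) hv hβ hβ1
  rw [sub_add_cancel] at h1
  rw [abs_of_nonneg (sub_nonneg.2 (Real.rpow_le_rpow hv h hβ)), abs_of_nonneg (sub_nonneg.2 h)]
  linarith

variable {C β r : ℝ} {z : Ctx d}

lemma abs_bump_sub_le (hC : 0 ≤ C) (hβ : 0 ≤ β) (hβ1 : β ≤ 1) (x y : Ctx d) :
    |bump C β r z x - bump C β r z y| ≤ C * ‖x - y‖ ^ β := by
  unfold bump
  rw [← mul_sub, abs_mul, abs_of_nonneg hC]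
  refine mul_le_mul_of_nonneg_left ?_ hC
  refine (abs_rpow_sub_rpow_le (le_max_right _ _) (le_max_right _ _) hβ hβ1).trans ?_
  refine Real.rpow_le_rpow (abs_nonneg _) ?_ hβ
  refine (abs_max_sub_max_le_abs _ _ _).trans ?_
  have e : r - ‖x - z‖ - (r - ‖y - z‖) = ‖y - z‖ - ‖x - z‖ := by ring
  rw [e]
  refine (abs_norm_sub_norm_le _ _).trans (le_of_eq ?_)
  rw [sub_sub_sub_cancel_right, norm_sub_rev]

lemma bump_nonneg (hC : 0 ≤ C) (x : Ctx d) : 0 ≤ bump C β r z x :=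
  mul_nonneg hC (Real.rpow_nonneg (le_max_right _ _) _)

lemma bump_le (hC : 0 ≤ C) (hβ : 0 ≤ β) (hr : 0 ≤ r) (x : Ctx d) :
    bump C β r z x ≤ C * r ^ β := by
  refine mul_le_mul_of_nonneg_left (Real.rpow_le_rpow (le_max_right _ _) ?_ hβ) hC
  exact max_le (by linarith [norm_nonneg (x - z)]) hr

lemma bump_eq_zero (hβ : 0 < β) {x : Ctx d} (hx : r ≤ ‖x - z‖) : bump C β r z x = 0 := by
  unfold bump
  rw [max_eq_right (by linarith), Real.zero_rpow hβ.ne', mul_zero]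

lemma mem_ball_of_bump_ne_zero (hβ : 0 < β) {x : Ctx d} (hx : bump C β r z x ≠ 0) :
    x ∈ Metric.ball z r := by
  rw [Metric.mem_ball, dist_eq_norm]
  by_contra h
  exact hx (bump_eq_zero hβ (not_lt.1 h))

lemma measurable_bump : Measurable (bump C β r z) := by
  unfold bump
  fun_prop

lemma uniformCube_real_le {s : Set (Ctx d)} (hs : volume s ≠ ⊤) :
    (uniformCube d).real s ≤ volume.real s :=
  ENNReal.toReal_mono hs (Measure.restrict_apply_le _ _)

/-- The volume of the unit ball. -/
noncomputable def ballVol (d : ℕ) : ℝ := (volume : Measure (Ctx d)).real (Metric.ball 0 1)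

lemma ballVol_pos (d : ℕ) : 0 < ballVol d :=
  ENNReal.toReal_pos (Metric.measure_ball_pos volume _ one_pos).ne' measure_ball_lt_top.ne

lemma volume_real_ball (z : Ctx d) {r : ℝ} (hr : 0 < r) :
    (volume : Measure (Ctx d)).real (Metric.ball z r) = r ^ d * ballVol d := by
  unfold Measure.real ballVol
  rw [Measure.addHaar_ball_of_pos _ _ hr, ENNReal.toReal_mul, finrank_euclideanSpace_fin,
    ENNReal.toReal_ofReal (by positivity)]
  rfl

/-- The context region in which the bump is positive but at most `δ` lies in a thin shell. -/
lemma bump_level_subset (hC : 0 < C) (hβ : 0 < β) {δ : ℝ} :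
    {x : Ctx d | 0 < bump C β r z x ∧ bump C β r z x ≤ δ}
      ⊆ {x | ‖x - z‖ < r ∧ r - (δ / C) ^ β⁻¹ ≤ ‖x - z‖} := by
  rintro x ⟨h0, h1⟩
  have hb : ‖x - z‖ < r := by
    have := mem_ball_of_bump_ne_zero hβ h0.ne'
    rwa [Metric.mem_ball, dist_eq_norm] at this
  refine ⟨hb, ?_⟩
  unfold bump at h1
  rw [max_eq_left (by linarith), mul_comm, ← le_div_iff₀ hC] at h1
  have h2 := Real.rpow_le_rpow (Real.rpow_nonneg (by linarith) _) h1 (inv_nonneg.2 hβ.le)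
  rw [Real.rpow_rpow_inv (by linarith) hβ.ne'] at h2
  linarith

/-- The level set lies in a shell of width `a = (δ / C) ^ (1 / β)`. Bernoulli's inequality bounds
its volume by `d * (a / r)` times that of the ball, and `a / r ≤ (a / r) ^ (α * β)` since `α * β ≤
1`. If `a ≥ r`, the whole ball will do. -/
lemma uniformCube_bump_level_le (hd : 1 ≤ d) (hC : 0 < C) (hβ : 0 < β) (hr : 0 < r) {α : ℝ}
    (hα : 0 < α) (hαβ : α * β ≤ 1) {δ : ℝ} (hδ : 0 ≤ δ) :
    (uniformCube d).real {x | 0 < bump C β r z x ∧ bump C β r z x ≤ δ}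
      ≤ ballVol d * d * r ^ ((d : ℝ) - α * β) * (δ / C) ^ α := by
  have hV := ballVol_pos d
  have hd' : (1 : ℝ) ≤ d := by exact_mod_cast hd
  set a := (δ / C) ^ β⁻¹ with ha
  have ha0 : 0 ≤ a := Real.rpow_nonneg (by positivity) _
  have hpow : r ^ ((d : ℝ) - α * β) * (δ / C) ^ α = r ^ d * (a / r) ^ (α * β) := by
    rw [Real.div_rpow ha0 hr.le, ha, ← Real.rpow_mul (by positivity)]
    have : β⁻¹ * (α * β) = α := by field_simp
    rw [this, Real.rpow_sub hr, Real.rpow_natCast]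
    ring
  have hgoal : volume.real {x : Ctx d | ‖x - z‖ < r ∧ r - a ≤ ‖x - z‖}
      ≤ ballVol d * d * (r ^ d * (a / r) ^ (α * β)) := by
    rcases le_or_gt r a with har | har
    · have h1 : {x : Ctx d | ‖x - z‖ < r ∧ r - a ≤ ‖x - z‖} ⊆ Metric.ball z r := fun x hx => by
        rw [Metric.mem_ball, dist_eq_norm]; exact hx.1
      refine (measureReal_mono h1 measure_ball_lt_top.ne).trans ?_
      rw [volume_real_ball z hr]
      have h2 : 1 ≤ (a / r) ^ (α * β) :=
        Real.one_le_rpow ((one_le_div hr).2 har) (by positivity)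
      calc r ^ d * ballVol d = ballVol d * 1 * (r ^ d * 1) := by ring
        _ ≤ _ := by gcongr
    · have hra : 0 < r - a := by linarith
      have h1 : {x : Ctx d | ‖x - z‖ < r ∧ r - a ≤ ‖x - z‖}
          = Metric.ball z r \ Metric.ball z (r - a) := by
        ext x
        simp [dist_eq_norm]
      rw [h1, measureReal_sdiff (Metric.ball_subset_ball (by linarith)) measurableSet_ball,
        volume_real_ball z hr, volume_real_ball z hra]
      have hq0 : 0 ≤ a / r := by positivity
      have hq1 : a / r ≤ 1 := (div_le_one hr).2 har.le
      have hbern := one_add_mul_le_pow (a := -(a / r)) (by linarith) d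
      have h2 : (r - a) ^ d = r ^ d * (1 + -(a / r)) ^ d := by
        rw [← mul_pow]
        congr 1
        field_simp
        ring
      have h3 : a / r ≤ (a / r) ^ (α * β) := by
        rcases hq0.eq_or_lt with h | h
        · rw [← h]
          exact Real.rpow_nonneg le_rfl _
        · calc a / r = (a / r) ^ (1 : ℝ) := (Real.rpow_one _).symm
            _ ≤ _ := Real.rpow_le_rpow_of_exponent_ge h hq1 hαβ
      rw [h2]
      calc r ^ d * ballVol d - r ^ d * (1 + -(a / r)) ^ d * ballVol d
          = ballVol d * r ^ d * (1 - (1 + -(a / r)) ^ d) := by ring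
        _ ≤ ballVol d * r ^ d * (d * (a / r) ^ (α * β)) := by
            refine mul_le_mul_of_nonneg_left ?_ (by positivity)
            have := mul_le_mul_of_nonneg_left h3 (by linarith : (0 : ℝ) ≤ d)
            linarith
        _ = _ := by ring
  have hfin : volume {x : Ctx d | ‖x - z‖ < r ∧ r - a ≤ ‖x - z‖} ≠ ⊤ := by
    refine (lt_of_le_of_lt (measure_mono (fun x hx => ?_))
      (measure_ball_lt_top (x := z) (r := r))).ne
    rw [Metric.mem_ball, dist_eq_norm]; exact hx.1
  calc (uniformCube d).real {x | 0 < bump C β r z x ∧ bump C β r z x ≤ δ}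
      ≤ (uniformCube d).real {x | ‖x - z‖ < r ∧ r - a ≤ ‖x - z‖} :=
        measureReal_mono (bump_level_subset hC hβ)
    _ ≤ _ := uniformCube_real_le hfin
    _ ≤ _ := hgoal
    _ = _ := by rw [← hpow]; ring

lemma integral_bump_sq_le (hC : 0 ≤ C) (hβ : 0 < β) (hr : 0 < r) :
    ∫ x, bump C β r z x ^ 2 ∂(uniformCube d) ≤ C ^ 2 * ballVol d * r ^ (2 * β + d) := by
  have h : ∀ x, bump C β r z x ^ 2
      ≤ (Metric.ball z r).indicator (fun _ => (C * r ^ β) ^ 2) x := by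
    intro x
    by_cases hx : x ∈ Metric.ball z r
    · rw [Set.indicator_of_mem hx]
      exact pow_le_pow_left₀ (bump_nonneg hC x) (bump_le hC hβ.le hr.le x) 2
    · rw [Set.indicator_of_notMem hx]
      rw [Metric.mem_ball, dist_eq_norm, not_lt] at hx
      rw [bump_eq_zero hβ hx]
      norm_num
  calc ∫ x, bump C β r z x ^ 2 ∂(uniformCube d)
      ≤ ∫ x, (Metric.ball z r).indicator (fun _ => (C * r ^ β) ^ 2) x ∂(uniformCube d) :=
        integral_mono_of_nonneg (Filter.Eventually.of_forall fun _ => sq_nonneg _)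
          ((integrable_const _).indicator measurableSet_ball) (Filter.Eventually.of_forall h)
    _ = (uniformCube d).real (Metric.ball z r) * (C * r ^ β) ^ 2 := by
        rw [integral_indicator_const _ measurableSet_ball, smul_eq_mul]
    _ ≤ (r ^ d * ballVol d) * (C * r ^ β) ^ 2 := by
        refine mul_le_mul_of_nonneg_right ?_ (sq_nonneg _)
        rw [← volume_real_ball z hr]
        exact uniformCube_real_le measure_ball_lt_top.ne
    _ = _ := by
        rw [Real.rpow_add hr, Real.rpow_natCast, mul_comm 2 β, Real.rpow_mul hr.le]
        norm_num
        ring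

lemma le_integral_bump (hC : 0 ≤ C) (hβ : 0 < β) (hr : 0 < r) :
    C * (r / 2) ^ β * (uniformCube d).real (Metric.ball z (r / 2))
      ≤ ∫ x, bump C β r z x ∂(uniformCube d) := by
  have h : ∀ x, (Metric.ball z (r / 2)).indicator (fun _ => C * (r / 2) ^ β) x
      ≤ bump C β r z x := by
    intro x
    by_cases hx : x ∈ Metric.ball z (r / 2)
    · rw [Set.indicator_of_mem hx]
      rw [Metric.mem_ball, dist_eq_norm] at hx
      refine mul_le_mul_of_nonneg_left (Real.rpow_le_rpow (by positivity) ?_ hβ.le) hC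
      exact le_max_of_le_left (by linarith)
    · rw [Set.indicator_of_notMem hx]
      exact bump_nonneg hC x
  rw [mul_comm, ← smul_eq_mul, ← integral_indicator_const _ measurableSet_ball]
  refine integral_mono ((integrable_const _).indicator measurableSet_ball) ?_ h
  refine integrable_of_bound measurable_bump (C := C * r ^ β) fun x => ?_
  rw [abs_of_nonneg (bump_nonneg hC x)]
  exact bump_le hC hβ.le hr.le x

lemma uniformCube_real_ball (hr : 0 < r) (h : Metric.ball z r ⊆ cube d) :
    (uniformCube d).real (Metric.ball z r) = r ^ d * ballVol d := by
  rw [← volume_real_ball z hr]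
  unfold uniformCube
  rw [measureReal_restrict_apply measurableSet_ball, Set.inter_eq_left.2 h]

end Bump

/-! ### Smoothness and margin of signed sums of bumps. -/

section BumpGap

variable {d : ℕ} {ι : Type*} [Fintype ι] {φ : ι → Ctx d → ℝ}

/-- At most one bump is alive at `x` and one at `y`, whatever the signs; the resulting factor `2` is
the one that `gapInstance_mem` can afford. -/
lemma IsBumpFamily.abs_bumpGap_sub_le (hφ : IsBumpFamily φ) (σ : ι → Arm) {x y : Ctx d} {h : ℝ}
    (hh : 0 ≤ h) (hxy : ∀ k, |φ k x - φ k y| ≤ h) :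
    |bumpGap φ σ x - bumpGap φ σ y| ≤ 2 * h := by
  classical
  have hfin : ∀ x, ∃ A : Finset ι, A.card ≤ 1 ∧ ∀ k ∉ A, φ k x = 0 := by
    intro x
    rcases hφ.eq_single_or_zero x with h | ⟨i, h⟩
    · exact ⟨∅, by simp, fun k _ => h k⟩
    · exact ⟨{i}, by simp, fun k hk => h k (by simpa using hk)⟩
  obtain ⟨A, hA1, hA⟩ := hfin x
  obtain ⟨B, hB1, hB⟩ := hfin y
  have e : bumpGap φ σ x - bumpGap φ σ y
      = ∑ k ∈ A ∪ B, armSign (σ k) * (φ k x - φ k y) := by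
    unfold bumpGap
    rw [← Finset.sum_sub_distrib]
    simp only [← mul_sub]
    refine (Finset.sum_subset (Finset.subset_univ _) fun k _ hk => ?_).symm
    rw [Finset.mem_union, not_or] at hk
    rw [hA k hk.1, hB k hk.2, sub_zero, mul_zero]
  have hs : ∀ c : Arm, |armSign c| = 1 := fun c => by unfold armSign; split_ifs <;> simp
  rw [e]
  calc _ ≤ ∑ k ∈ A ∪ B, |armSign (σ k) * (φ k x - φ k y)| := Finset.abs_sum_le_sum_abs _ _
    _ ≤ ∑ _k ∈ A ∪ B, h := Finset.sum_le_sum fun k _ => by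
        rw [abs_mul, hs, one_mul]; exact hxy k
    _ = ((A ∪ B).card : ℝ) * h := by rw [Finset.sum_const, nsmul_eq_mul]
    _ ≤ 2 * h := by
        refine mul_le_mul_of_nonneg_right ?_ hh
        have := Finset.card_union_le A B
        exact_mod_cast (by omega : (A ∪ B).card ≤ 2)

lemma IsBumpFamily.uniformCube_level_le (hφ : IsBumpFamily φ) (σ : ι → Arm) (δ : ℝ) :
    (uniformCube d).real {x | 0 < |bumpGap φ σ x| ∧ |bumpGap φ σ x| ≤ δ}
      ≤ ∑ k, (uniformCube d).real {x | 0 < φ k x ∧ φ k x ≤ δ} := by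
  refine le_trans (measureReal_mono (s₂ := ⋃ k ∈ Finset.univ, {x | 0 < φ k x ∧ φ k x ≤ δ})
    ?_ (measure_ne_top _ _))
    (measureReal_biUnion_finset_le _ _)
  intro x hx
  simp only [Set.mem_ofPred_eq] at hx
  simp only [Finset.mem_univ, Set.iUnion_true, Set.mem_iUnion, Set.mem_ofPred_eq]
  rcases hφ.eq_single_or_zero x with h | ⟨i, h⟩
  · simp [bumpGap, h] at hx
  · refine ⟨i, ?_⟩
    have hs : |armSign (σ i)| = 1 := by unfold armSign; split_ifs <;> simp
    have : |bumpGap φ σ x| = φ i x := by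
      unfold bumpGap
      rw [Finset.sum_eq_single i (fun j _ hj => by rw [h j hj, mul_zero]) (by simp), abs_mul,
        hs, one_mul, abs_of_nonneg (hφ.nonneg i x)]
    rwa [this] at hx

end BumpGap

/-! ### Disjoint cells in the boxes along the diagonal of the cube. -/

section Cells

variable {d M : ℕ}

/-- The centres of the cells: the box `[j/M, (j+1)/M]^d` is split into `(K j)^d` cells. -/
noncomputable def cellCenter (K : Fin M → ℕ) (k : Σ j : Fin M, Fin d → Fin (K j)) : Ctx d :=
  WithLp.toLp 2 fun i => ((k.1 : ℕ) : ℝ) / M + (2 * ((k.2 i : ℕ) : ℝ) + 1) / (2 * M * K k.1)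

lemma nat_eq_of_mem_Ioo {y : ℝ} {m n : ℕ} (hm : (m : ℝ) < y ∧ y < m + 1)
    (hn : (n : ℝ) < y ∧ y < n + 1) : m = n := by
  have h1 : (m : ℝ) < n + 1 := hm.1.trans hn.2
  have h2 : (n : ℝ) < m + 1 := hn.1.trans hm.2
  have h1' : m < n + 1 := by exact_mod_cast h1
  have h2' : n < m + 1 := by exact_mod_cast h2
  omega

/-- The hypothesis `hr` says that `r` is at most half the side `1 / (M * K)` of a cell. In rescaled
coordinates a cell is an open unit cube with integer corners, so its indices can be read off from
any of its points. -/
lemma mem_cell {K : Fin M → ℕ} {k : Σ j : Fin M, Fin d → Fin (K j)} {r : ℝ}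
    (hr : r * (2 * M * K k.1) ≤ 1) {x : Ctx d} (hx : x ∈ Metric.ball (cellCenter K k) r)
    (i : Fin d) :
    ((k.2 i : ℕ) : ℝ) < (M * x i - (k.1 : ℕ)) * K k.1 ∧
      (M * x i - (k.1 : ℕ)) * K k.1 < (k.2 i : ℕ) + 1 := by
  have hM : 0 < M := lt_of_le_of_lt (Nat.zero_le _) k.1.2
  have hK : 0 < K k.1 := lt_of_le_of_lt (Nat.zero_le _) (k.2 i).2
  have hM' : (0 : ℝ) < M := by exact_mod_cast hM
  have hK' : (0 : ℝ) < K k.1 := by exact_mod_cast hK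
  rw [Metric.mem_ball, dist_eq_norm] at hx
  have h1 := (PiLp.norm_apply_le (x - cellCenter K k) i).trans_lt hx
  rw [PiLp.sub_apply, Real.norm_eq_abs, abs_lt] at h1
  have e : x i - cellCenter K k i
      = (((M * x i - (k.1 : ℕ)) * K k.1) - ((k.2 i : ℕ) + 1 / 2)) / (M * K k.1) := by
    simp only [cellCenter]
    field_simp
    ring
  have h2 : r ≤ (1 / 2) / (M * K k.1) := by
    rw [le_div_iff₀ (by positivity)]
    linarith
  rw [e] at h1
  have h3 := (lt_div_iff₀ (by positivity)).1 (lt_of_le_of_lt (neg_le_neg h2) h1.1)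
  have h4 := (div_lt_div_iff_of_pos_right (by positivity)).1 (h1.2.trans_le h2)
  have h5 : -(1 / 2 / (M * (K k.1 : ℝ))) * (M * K k.1) = -(1 / 2) := by field_simp
  rw [h5] at h3
  constructor <;> linarith

lemma mem_box {K : Fin M → ℕ} {k : Σ j : Fin M, Fin d → Fin (K j)} {r : ℝ}
    (hr : r * (2 * M * K k.1) ≤ 1) {x : Ctx d} (hx : x ∈ Metric.ball (cellCenter K k) r)
    (i : Fin d) : ((k.1 : ℕ) : ℝ) < M * x i ∧ M * x i < (k.1 : ℕ) + 1 := by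
  have h := mem_cell hr hx i
  have hK : 0 < K k.1 := lt_of_le_of_lt (Nat.zero_le _) (k.2 i).2
  have hK' : (0 : ℝ) < K k.1 := by exact_mod_cast hK
  have hk : ((k.2 i : ℕ) : ℝ) + 1 ≤ K k.1 := by exact_mod_cast (k.2 i).2
  have hk0 : (0 : ℝ) ≤ ((k.2 i : ℕ) : ℝ) := Nat.cast_nonneg _
  constructor
  · have := pos_of_mul_pos_left (hk0.trans_lt h.1) hK'.le
    linarith
  · have : (M * x i - (k.1 : ℕ)) * K k.1 < 1 * K k.1 := by linarith [h.2]
    have := lt_of_mul_lt_mul_right this hK'.le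
    linarith

lemma cell_ball_subset_cube {K : Fin M → ℕ} {k : Σ j : Fin M, Fin d → Fin (K j)} {r : ℝ}
    (hr : r * (2 * M * K k.1) ≤ 1) : Metric.ball (cellCenter K k) r ⊆ cube d := by
  intro x hx i
  have h := mem_box hr hx i
  have hM : 0 < M := lt_of_le_of_lt (Nat.zero_le _) k.1.2
  have hM' : (0 : ℝ) < M := by exact_mod_cast hM
  have hk : ((k.1 : ℕ) : ℝ) + 1 ≤ M := by exact_mod_cast k.1.2
  have hk0 : (0 : ℝ) ≤ ((k.1 : ℕ) : ℝ) := Nat.cast_nonneg _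
  constructor
  · exact (pos_of_mul_pos_right (hk0.trans_lt h.1) hM'.le).le
  · have : M * x i < M * 1 := by linarith [h.2]
    exact (lt_of_mul_lt_mul_left this hM'.le).le

lemma cell_eq_of_mem (hd : 1 ≤ d) {K : Fin M → ℕ} {r : Fin M → ℝ}
    (hr : ∀ j, r j * (2 * M * K j) ≤ 1) {k k' : Σ j : Fin M, Fin d → Fin (K j)} {x : Ctx d}
    (hx : x ∈ Metric.ball (cellCenter K k) (r k.1))
    (hx' : x ∈ Metric.ball (cellCenter K k') (r k'.1)) : k = k' := by
  obtain ⟨j, v⟩ := k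
  obtain ⟨j', v'⟩ := k'
  have hj : j = j' := Fin.ext (nat_eq_of_mem_Ioo (mem_box (hr j) hx ⟨0, hd⟩)
    (mem_box (hr j') hx' ⟨0, hd⟩))
  subst hj
  congr
  funext i
  exact Fin.ext (nat_eq_of_mem_Ioo (mem_cell (hr j) hx i) (mem_cell (hr j) hx' i))

end Cells

/-! ### Critical times and radii. -/

section Thresholds

/-- Times such that one batch has to cover a window from `a i` to `a (i + 1)`, and the length of
each window is large compared with a power of its starting time. -/
lemma exists_thresholds {γ : ℝ} (hγ0 : 0 < γ) (hγ1 : γ < 1) {T M : ℕ} (hT : 1 ≤ T) (hM : 1 ≤ M) :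
    ∃ (a : ℕ → ℕ) (τ : ℕ → ℝ), a 0 = 0 ∧ (∀ i < M, a i ≤ a (i + 1) ∧ a (i + 1) < T) ∧
      ∀ i < M, 1 ≤ τ i ∧ (a i : ℝ) ≤ τ i ∧
        (T : ℝ) ^ ((1 - γ) / (1 - γ ^ M)) * τ i ^ γ * (1 / (M : ℝ) / 2)
          ≤ (a (i + 1) : ℝ) + 1 - a i := by
  have hM0 : (0 : ℝ) < M := by exact_mod_cast hM
  have hT1 : (1 : ℝ) ≤ T := by exact_mod_cast hT
  have hT0 : (0 : ℝ) < T := by linarith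
  have hγM : 0 < 1 - γ ^ M := by
    have := pow_lt_one₀ hγ0.le hγ1 (by omega : M ≠ 0)
    linarith
  set τ : ℕ → ℝ := fun i => (T : ℝ) ^ ((1 - γ ^ i) / (1 - γ ^ M)) with hτ
  have hτ1 : ∀ i, 1 ≤ τ i := fun i => Real.one_le_rpow hT1
    (div_nonneg (by linarith [pow_le_one₀ hγ0.le hγ1.le (n := i)]) hγM.le)
  have hτmono : ∀ i, τ i ≤ τ (i + 1) := fun i => by
    refine Real.rpow_le_rpow_of_exponent_le hT1 (div_le_div_of_nonneg_right ?_ hγM.le)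
    linarith [pow_le_pow_of_le_one hγ0.le hγ1.le (Nat.le_add_right i 1)]
  have hτM : τ M = T := by simp [hτ, div_self hγM.ne']
  have hτle : ∀ i ≤ M, τ i ≤ T := fun i hi => by
    rw [← hτM]
    exact monotone_nat_of_le_succ hτmono hi
  have hstep : ∀ i, τ (i + 1) = (T : ℝ) ^ ((1 - γ) / (1 - γ ^ M)) * τ i ^ γ := fun i => by
    simp only [hτ]
    rw [← Real.rpow_mul hT0.le, ← Real.rpow_add hT0]
    congr 1
    field_simp
    ring
  -- Consecutive `τ i` can be arbitrarily close in ratio. The factor, which grows from `1 / 2` to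
  -- `1` in steps of `1 / (2 * M)`, separates them by at least `τ (i + 1) / (2 * M)`.
  set u : ℕ → ℝ := fun i => τ i * ((1 + i / M) / 2) with hu
  have hu0 : ∀ i, 0 < u i := fun i => mul_pos (by linarith [hτ1 i]) (by positivity)
  have hfrac : ∀ i ≤ M, ((1 : ℝ) + i / M) / 2 ≤ 1 := fun i hi => by
    have : (i : ℝ) / M ≤ 1 := (div_le_one hM0).2 (by exact_mod_cast hi)
    linarith
  have hule : ∀ i ≤ M, u i ≤ τ i := fun i hi =>
    mul_le_of_le_one_right (by linarith [hτ1 i]) (hfrac i hi)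
  have hudiff : ∀ i, τ (i + 1) * (1 / (M : ℝ) / 2) ≤ u (i + 1) - u i := fun i => by
    have h := mul_le_mul_of_nonneg_right (hτmono i)
      (by positivity : (0 : ℝ) ≤ (1 + i / M) / 2)
    have e : u (i + 1) = τ (i + 1) * (1 / (M : ℝ) / 2) + τ (i + 1) * ((1 + i / M) / 2) := by
      simp only [hu]
      push_cast
      ring
    have e' : u i = τ i * ((1 + i / M) / 2) := rfl
    linarith
  have humono : ∀ i, u i ≤ u (i + 1) := fun i => by
    have : 0 ≤ τ (i + 1) * (1 / (M : ℝ) / 2) :=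
      mul_nonneg (by linarith [hτ1 (i + 1)]) (by positivity)
    linarith [hudiff i]
  have hc1 : ∀ i, 1 ≤ ⌈u i⌉₊ := fun i => Nat.one_le_iff_ne_zero.2 (Nat.ceil_pos.2 (hu0 i)).ne'
  have hcast : ∀ i, ((⌈u i⌉₊ - 1 : ℕ) : ℝ) = (⌈u i⌉₊ : ℝ) - 1 := fun i => by
    rw [Nat.cast_sub (hc1 i), Nat.cast_one]
  -- Rounding up and subtracting `1` gives `a 0 = 0`, as `u 0 = 1 / 2`, and `a i < T` strictly; the
  -- window with both ends included still has length at least `u (i + 1) - u i`.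
  refine ⟨fun i => ⌈u i⌉₊ - 1, τ, ?_, fun i hi => ⟨?_, ?_⟩, fun i hi => ⟨hτ1 i, ?_, ?_⟩⟩
  · have : ⌈u 0⌉₊ ≤ 1 := Nat.ceil_le.2 (by simp [hu, hτ]; norm_num)
    simp only
    omega
  · exact Nat.sub_le_sub_right (Nat.ceil_mono (humono i)) 1
  · have h1 : ⌈u (i + 1)⌉₊ ≤ T := Nat.ceil_le.2 ((hule _ hi).trans (hτle _ hi))
    have h2 := hc1 (i + 1)
    simp only
    omega
  · simp only [hcast]
    have := Nat.ceil_lt_add_one (hu0 i).le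
    linarith [hule i hi.le]
  · rw [← hstep]
    simp only [hcast]
    have h1 := Nat.ceil_lt_add_one (hu0 i).le
    have h2 := Nat.le_ceil (u (i + 1))
    linarith [hudiff i]

lemma eventually_rpow_le {p ε : ℝ} (hp : 0 < p) (hε : 0 < ε) :
    ∀ᶠ x : ℝ in nhdsWithin 0 (Set.Ioi 0), x ^ p ≤ ε := by
  have h : Filter.Tendsto (fun x : ℝ => x ^ p) (nhdsWithin 0 (Set.Ioi 0)) (nhds 0) := by
    have := (Real.continuousAt_rpow_const 0 p (Or.inr hp.le)).tendsto
    rw [Real.zero_rpow hp.ne'] at this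
    exact this.mono_left nhdsWithin_le_nhds
  exact h.eventually_le_const hε

lemma gammaExp_pos {d : ℕ} {α β : ℝ} (hα : 0 < α) (hβ : 0 < β) : 0 < gammaExp d α β := by
  unfold gammaExp
  positivity

lemma gammaExp_lt_one {d : ℕ} (hd : 1 ≤ d) {α β : ℝ} (hβ : 0 < β) (hαβ : α * β ≤ 1) :
    gammaExp d α β < 1 := by
  have hd' : (1 : ℝ) ≤ d := by exact_mod_cast hd
  unfold gammaExp
  rw [div_lt_one (by positivity)]
  nlinarith

/-- Powers of the radius `ρ τ ^ (-1 / (2 β + d))`. -/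
lemma radius_facts {d : ℕ} {α β ρ τ : ℝ} (hβ : 0 < β) (hρ : 0 < ρ) (hτ : 1 ≤ τ) :
    let r := ρ * τ ^ (-(1 / (2 * β + d)))
    0 < r ∧ r ≤ ρ ∧ τ * r ^ (2 * β + d) = ρ ^ (2 * β + d) ∧
      τ ^ gammaExp d α β * r ^ (β * (1 + α)) = ρ ^ (β * (1 + α)) := by
  have hτ0 : 0 < τ := by linarith
  have he : 0 < 2 * β + d := by positivity
  intro r
  refine ⟨by positivity, ?_, ?_, ?_⟩
  · refine mul_le_of_le_one_right hρ.le (Real.rpow_le_one_of_one_le_of_nonpos hτ ?_)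
    have : 0 < 1 / (2 * β + d) := by positivity
    linarith
  · simp only [r]
    rw [Real.mul_rpow hρ.le (by positivity), ← Real.rpow_mul hτ0.le]
    have : -(1 / (2 * β + d)) * (2 * β + d) = -1 := by field_simp
    rw [this, Real.rpow_neg_one]
    field_simp
  · simp only [r]
    rw [Real.mul_rpow hρ.le (by positivity), ← Real.rpow_mul hτ0.le]
    have : -(1 / (2 * β + d)) * (β * (1 + α)) = -gammaExp d α β := by
      unfold gammaExp
      field_simp
    rw [this, Real.rpow_neg hτ0.le]
    have := (Real.rpow_pos_of_pos hτ0 (gammaExp d α β)).ne'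
    field_simp

end Thresholds

/-! ### The instances with bumps of all scales. -/

section CellBumps

variable {d M : ℕ} {α β L δ₀ D₀ : ℝ} {r : ℕ → ℝ} {K : ℕ → ℕ}

/-- The bumps of radius `r j` in the `(K j)^d` cells of the box `j`, for all `j < M`. -/
noncomputable def cellBump (M : ℕ) (L β : ℝ) (r : ℕ → ℝ) (K : ℕ → ℕ)
    (k : Σ j : Fin M, Fin d → Fin (K j)) : Ctx d → ℝ :=
  bump L β (r k.1) (cellCenter (fun j : Fin M => K j) k)

lemma isBumpFamily_cellBump (hd : 1 ≤ d) (hβ : 0 < β) (hL : 0 < L) (hr : ∀ j < M, 0 < r j)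
    (hrL : ∀ j < M, L * r j ^ β ≤ 1 / 2) (hK : ∀ j < M, r j * (2 * M * K j) ≤ 1) :
    IsBumpFamily (cellBump (d := d) M L β r K) := by
  refine ⟨fun _ => measurable_bump, fun _ x => bump_nonneg hL.le x, fun k x => ?_,
    fun k k' x hx hx' => ?_⟩
  · exact (bump_le hL.le hβ.le (hr k.1 k.1.2).le x).trans (hrL k.1 k.1.2)
  · exact cell_eq_of_mem (r := fun j => r j) hd (fun j => hK j j.2)
      (mem_ball_of_bump_ne_zero hβ hx) (mem_ball_of_bump_ne_zero hβ hx')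

/-- The level sets of the bumps add up, and `hcount` shares the margin budget `D₀ * L ^ α` equally
among the `M` scales. -/
lemma gapInstance_cellBump_mem (hd : 1 ≤ d) (hα : 0 < α) (hβ : 0 < β) (hβ1 : β ≤ 1)
    (hαβ : α * β ≤ 1) (hL : 0 < L) (hM : 1 ≤ M) (hr : ∀ j < M, 0 < r j)
    (hcount : ∀ j < M, (M : ℝ) * ((K j : ℝ) ^ d * (ballVol d * d * r j ^ ((d : ℝ) - α * β)))
      ≤ D₀ * L ^ α)
    (hφ : IsBumpFamily (cellBump (d := d) M L β r K))
    (σ : (Σ j : Fin M, Fin d → Fin (K j)) → Arm) :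
    gapInstance (bumpGap (cellBump M L β r K) σ) (hφ.isGap σ)
      ∈ instanceClass (uniformCube d) α β L δ₀ D₀ := by
  refine gapInstance_mem (hφ.isGap σ) ?_ ?_
  · intro y _ y' _
    have h := hφ.abs_bumpGap_sub_le σ (x := y) (y := y') (h := L * ‖y - y'‖ ^ β)
      (by positivity) fun k => abs_bump_sub_le hL.le hβ.le hβ1 y y'
    linarith
  · intro δ hδ
    have hM0 : (0 : ℝ) < M := by exact_mod_cast hM
    have h4 : L ^ α * (δ / L) ^ α = δ ^ α := by
      rw [← Real.mul_rpow hL.le (by positivity)]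
      congr 1
      field_simp
    refine (hφ.uniformCube_level_le σ δ).trans ?_
    rw [Fintype.sum_sigma]
    calc ∑ j : Fin M, ∑ v : Fin d → Fin (K j), (uniformCube d).real
          {x | 0 < cellBump M L β r K ⟨j, v⟩ x ∧ cellBump M L β r K ⟨j, v⟩ x ≤ δ}
        ≤ ∑ j : Fin M, ∑ _v : Fin d → Fin (K j),
            ballVol d * d * r j ^ ((d : ℝ) - α * β) * (δ / L) ^ α :=
          Finset.sum_le_sum fun j _ => Finset.sum_le_sum fun v _ =>
            uniformCube_bump_level_le hd hL hβ (hr j j.2) hα hαβ hδ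
      _ = ∑ j : Fin M, ((K j : ℝ) ^ d * (ballVol d * d * r j ^ ((d : ℝ) - α * β)))
            * (δ / L) ^ α := by
          refine Finset.sum_congr rfl fun j _ => ?_
          rw [Finset.sum_const, Finset.card_univ, nsmul_eq_mul, Fintype.card_fun, Fintype.card_fin,
            Fintype.card_fin]
          push_cast
          ring
      _ ≤ ∑ _j : Fin M, (D₀ * L ^ α / M) * (δ / L) ^ α := by
          refine Finset.sum_le_sum fun j _ => mul_le_mul_of_nonneg_right ?_ (by positivity)
          rw [le_div_iff₀ hM0, mul_comm]
          exact hcount j j.2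
      _ = D₀ * (L ^ α * (δ / L) ^ α) := by
          rw [Finset.sum_const, Finset.card_univ, Fintype.card_fin, nsmul_eq_mul]
          field_simp
      _ = _ := by rw [h4]

lemma exists_le_regret_cellBump (hβ : 0 < β) (hL : 0 < L) (hM : 1 ≤ M) (hr : ∀ j < M, 0 < r j)
    (hK : ∀ j < M, r j * (2 * M * K j) ≤ 1)
    (hφ : IsBumpFamily (cellBump (d := d) M L β r K)) {T : ℕ} {S : Type*} [MeasurableSpace S]
    (ν : Measure S) [IsProbabilityMeasure ν] (p : BatchPolicy d T M S) {a : ℕ → ℕ}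
    (h0 : a 0 = 0) (ha : ∀ i < M, a i ≤ a (i + 1) ∧ a (i + 1) < T)
    (hinfo : ∀ i < M, 16 * (a i * (L ^ 2 * ballVol d * r i ^ (2 * β + d)))
      ≤ (1 / (4 * (M : ℝ))) ^ 2) {b : ℝ}
    (hb : ∀ i < M, b ≤ ((a (i + 1) : ℝ) + 1 - a i) *
      ((K i : ℝ) ^ d * (L * (r i / 2) ^ β * ((r i / 2) ^ d * ballVol d))) *
        (1 / (4 * (M : ℝ)))) :
    ∃ σ, b ≤ regret ν p (gapInstance (bumpGap (cellBump M L β r K) σ) (hφ.isGap σ)) := by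
  have hV := ballVol_pos d
  set B : ℕ → Finset (Σ j : Fin M, Fin d → Fin (K j)) := fun i =>
    if h : i < M then Finset.univ.map (Function.Embedding.sigmaMk ⟨i, h⟩) else ∅ with hB
  have hBmem : ∀ i < M, ∀ k ∈ B i, ((k.1 : ℕ)) = i := by
    intro i hi k hk
    simp only [hB, dif_pos hi, Finset.mem_map, Finset.mem_univ, true_and] at hk
    obtain ⟨v, rfl⟩ := hk
    rfl
  have hBcard : ∀ i < M, ((B i).card : ℝ) = (K i : ℝ) ^ d := by
    intro i hi
    simp only [hB, dif_pos hi, Finset.card_map, Finset.card_univ, Fintype.card_fun,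
      Fintype.card_fin]
    push_cast
    rfl
  refine exists_le_regret_of_bumps ν p hM hφ h0 ha B ?_ ?_
  · intro i hi k hk
    have h1 := integral_bump_sq_le (d := d) (z := cellCenter (fun j : Fin M => K j) k) hL.le hβ
      (hr k.1 k.1.2)
    rw [hBmem i hi k hk] at h1
    have e : cellBump M L β r K k = bump L β (r i) (cellCenter (fun j : Fin M => K j) k) := by
      unfold cellBump
      rw [hBmem i hi k hk]
    rw [e]
    have h2 := mul_le_mul_of_nonneg_left h1 (Nat.cast_nonneg (α := ℝ) (a i))
    linarith [hinfo i hi]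
  · intro i hi
    refine (hb i hi).trans (mul_le_mul_of_nonneg_right (mul_le_mul_of_nonneg_left ?_ ?_) ?_)
    · rw [← hBcard i hi, ← nsmul_eq_mul]
      refine Finset.card_nsmul_le_sum (B i) _ _ fun k hk => ?_
      have e : cellBump M L β r K k = bump L β (r i) (cellCenter (fun j : Fin M => K j) k) := by
        unfold cellBump
        rw [hBmem i hi k hk]
      have hri := hr i hi
      have hKi := hK i hi
      have hsub : Metric.ball (cellCenter (fun j : Fin M => K j) k) (r i / 2) ⊆ cube d := by
        refine cell_ball_subset_cube ?_
        rw [hBmem i hi k hk]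
        have : 0 ≤ 2 * (M : ℝ) * K i := by positivity
        nlinarith
      rw [e, ← uniformCube_real_ball (by positivity) hsub]
      exact le_integral_bump hL.le hβ hri
    · have : (a i : ℝ) ≤ a (i + 1) := by exact_mod_cast (ha i hi).1
      linarith
    · positivity

end CellBumps

/-! ### Choice of constants when `α * β < d`. -/

section Assembly

variable {d : ℕ} {α β L δ₀ D₀ : ℝ}

/-- The number of cells per axis: `⌊c m r ^ (-q/d)⌋`. -/
lemma floor_cell_facts (hd : 1 ≤ d) {q c m r : ℝ} (hqd : q ≤ d) (hc0 : 0 < c)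
    (hc : c ≤ 1 / 2) (hm : 0 < m) (hr0 : 0 < r) (hr1 : r ≤ 1) (hrq : r ^ (q / d) ≤ c * m) :
    r * (2 * (1 / m) * ⌊c * m * r ^ (-(q / d))⌋₊) ≤ 1 ∧
      (⌊c * m * r ^ (-(q / d))⌋₊ : ℝ) ^ d ≤ c ^ d * m ^ d * r ^ (-q) ∧
      c ^ d * m ^ d * r ^ (-q) / 2 ^ d ≤ (⌊c * m * r ^ (-(q / d))⌋₊ : ℝ) ^ d := by
  have hdpos : (0 : ℝ) < d := by exact_mod_cast hd
  set x := c * m * r ^ (-(q / d)) with hx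
  have hx1 : 1 ≤ x := by
    rw [hx, Real.rpow_neg hr0.le, ← div_eq_mul_inv, one_le_div (by positivity)]
    exact hrq
  have hxd : x ^ d = c ^ d * m ^ d * r ^ (-q) := by
    rw [hx, mul_pow, mul_pow, ← Real.rpow_natCast (r ^ (-(q / d))), ← Real.rpow_mul hr0.le]
    congr 2
    field_simp
  have hKx : (⌊x⌋₊ : ℝ) ≤ x := Nat.floor_le (by linarith)
  have hxK : x / 2 ≤ ⌊x⌋₊ := by
    have h2 : (1 : ℝ) ≤ ⌊x⌋₊ := by
      have : 1 ≤ ⌊x⌋₊ := (Nat.one_le_floor_iff _).2 hx1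
      exact_mod_cast this
    linarith [Nat.lt_floor_add_one x]
  refine ⟨?_, ?_, ?_⟩
  · have h1 : r * r ^ (-(q / d)) ≤ 1 := by
      have : r * r ^ (-(q / d)) = r ^ (1 + -(q / d)) := by
        rw [Real.rpow_add hr0, Real.rpow_one]
      rw [this]
      refine Real.rpow_le_one hr0.le hr1 ?_
      have : q / d ≤ 1 := (div_le_one hdpos).2 hqd
      linarith
    calc r * (2 * (1 / m) * ⌊x⌋₊) ≤ r * (2 * (1 / m) * x) := by gcongr
      _ = 2 * c * (r * r ^ (-(q / d))) := by rw [hx]; field_simp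
      _ ≤ 2 * c * 1 := by gcongr
      _ ≤ 1 := by linarith
  · rw [← hxd]
    exact pow_le_pow_left₀ (Nat.cast_nonneg _) hKx d
  · rw [← hxd, ← div_pow]
    exact pow_le_pow_left₀ (by linarith) hxK d

/-- The radius is scaled by `κ * m ^ k` with `m = 1 / M`: `κ` absorbs the constants and `k` the
required powers of `m`. -/
lemma rpow_scaled_le {κ m k t s ε : ℝ} (hκ : 0 < κ) (hm : 0 < m) (hm1 : m ≤ 1)
    (hκt : κ ^ t ≤ ε) (hks : s ≤ k * t) : (κ * m ^ k) ^ t ≤ ε * m ^ s := by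
  rw [Real.mul_rpow hκ.le (by positivity), ← Real.rpow_mul hm.le]
  exact mul_le_mul hκt (Real.rpow_le_rpow_of_exponent_ge hm hm1 hks) (by positivity)
    (le_trans (by positivity) hκt)

/-- The product that bounds the regret from below in terms of the radius. -/
lemma cell_regret_le {c m κ k r τ Q W N V : ℝ} {q : ℝ} (hq : q = d - α * β)
    (hL : 0 < L) (hV : 0 < V) (hc : 0 < c) (hm : 0 < m) (hκ : 0 < κ) (hr : 0 < r) (hτ : 0 < τ)
    (hQ : 0 < Q)
    (hrγ : τ ^ gammaExp d α β * r ^ (β * (1 + α)) = (κ * m ^ k) ^ (β * (1 + α)))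
    (hW : Q * τ ^ gammaExp d α β * (m / 2) ≤ W) (hN : c ^ d * m ^ d * r ^ (-q) / 2 ^ d ≤ N) :
    c ^ d * L * V * κ ^ (β * (1 + α)) / (8 * 2 ^ d * (2 ^ β * 2 ^ d)) *
        m ^ (2 + d + k * (β * (1 + α))) * Q
      ≤ W * (N * (L * (r / 2) ^ β * ((r / 2) ^ d * V))) * (m / 4) := by
  -- The number of bumps times the mass of one bump: exactly the power of `r` that `hrγ` cancels
  -- against `τ ^ γ`.
  have hexp : r ^ (-q) * r ^ β * r ^ d = r ^ (β * (1 + α)) := by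
    rw [← Real.rpow_natCast r d, ← Real.rpow_add hr, ← Real.rpow_add hr]
    congr 1
    rw [hq]
    ring
  have hmexp : m ^ (2 + d + k * (β * (1 + α))) = m ^ 2 * m ^ d * m ^ (k * (β * (1 + α))) := by
    rw [Real.rpow_add hm, Real.rpow_add hm, Real.rpow_natCast]
    norm_num
  rw [Real.mul_rpow hκ.le (by positivity), ← Real.rpow_mul hm.le] at hrγ
  calc c ^ d * L * V * κ ^ (β * (1 + α)) / (8 * 2 ^ d * (2 ^ β * 2 ^ d)) *
        m ^ (2 + d + k * (β * (1 + α))) * Q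
      = c ^ d * L * V / (8 * 2 ^ d * (2 ^ β * 2 ^ d)) * m ^ 2 * m ^ d * Q *
          (κ ^ (β * (1 + α)) * m ^ (k * (β * (1 + α)))) := by
        rw [hmexp]; ring
    _ = c ^ d * L * V / (8 * 2 ^ d * (2 ^ β * 2 ^ d)) * m ^ 2 * m ^ d * Q *
          (τ ^ gammaExp d α β * (r ^ (-q) * r ^ β * r ^ d)) := by rw [hexp, hrγ]
    _ = (Q * τ ^ gammaExp d α β * (m / 2)) *
          (c ^ d * m ^ d * r ^ (-q) / 2 ^ d * (L * (r / 2) ^ β * ((r / 2) ^ d * V)))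
          * (m / 4) := by
        rw [Real.div_rpow hr.le two_pos.le, div_pow]
        field_simp
        ring
    _ ≤ _ := by
        refine mul_le_mul_of_nonneg_right ?_ (by positivity)
        exact mul_le_mul hW (mul_le_mul_of_nonneg_right hN (by positivity)) (by positivity)
          (le_trans (by positivity) hW)

/-- The lower bound when the margin condition leaves room for many bumps. -/
lemma exists_lower_bound_of_lt (hd : 1 ≤ d) (hα : 0 < α) (hβ : 0 < β) (hβ1 : β ≤ 1)
    (hαβ : α * β ≤ 1) (hL : 0 < L) (hD₀ : 0 < D₀) (hlt : α * β < d) :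
    ∃ D₁ D₂ : ℝ, 0 < D₁ ∧ 0 < D₂ ∧ ∀ T M : ℕ, 1 ≤ T → 1 ≤ M →
      ∀ (S : Type*) [MeasurableSpace S] (ν : Measure S) [IsProbabilityMeasure ν]
        (p : BatchPolicy d T M S), ∃ I ∈ instanceClass (uniformCube d) α β L δ₀ D₀,
          D₁ * (1 / (M : ℝ)) ^ D₂ *
            (T : ℝ) ^ ((1 - gammaExp d α β) / (1 - gammaExp d α β ^ M)) ≤ regret ν p I := by
  have hdpos : (0 : ℝ) < d := by exact_mod_cast hd
  set V := ballVol d with hVdef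
  have hV : 0 < V := ballVol_pos d
  obtain ⟨q, hq⟩ : ∃ q : ℝ, q = d - α * β := ⟨_, rfl⟩
  have hq0 : 0 < q := by linarith
  have hqd : q ≤ d := by nlinarith
  obtain ⟨e, he⟩ : ∃ e : ℝ, e = 2 * β + d := ⟨_, rfl⟩
  have he0 : 0 < e := by rw [he]; positivity
  -- `c ≤ 1 / 2` makes the bumps fit into their cells; the last condition is the margin budget.
  obtain ⟨c, hc0, hc2, hcD⟩ : ∃ c : ℝ, 0 < c ∧ c ≤ 1 / 2 ∧ V * d * c ^ d ≤ D₀ * L ^ α := by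
    refine ⟨min (1 / 2) (D₀ * L ^ α / (V * d)), lt_min (by norm_num) (by positivity),
      min_le_left _ _, ?_⟩
    set c : ℝ := min (1 / 2) (D₀ * L ^ α / (V * d)) with hc
    have hc0 : 0 ≤ c := le_min (by norm_num) (by positivity)
    have h1 : c ^ d ≤ c := by
      calc c ^ d ≤ c ^ 1 := pow_le_pow_of_le_one hc0
            ((min_le_left _ _).trans (by norm_num)) hd
        _ = c := pow_one c
    have h2 : c ≤ D₀ * L ^ α / (V * d) := min_le_right _ _
    rw [le_div_iff₀ (by positivity)] at h2
    have := mul_le_mul_of_nonneg_left h1 (by positivity : 0 ≤ V * d)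
    linarith
  obtain ⟨κ, hκ1, hκ2, hκ3, hκ4, hκ0⟩ : ∃ κ : ℝ, κ ^ (1 : ℝ) ≤ 1 ∧ κ ^ β ≤ 1 / (2 * L) ∧
      κ ^ (q / d) ≤ c ∧ κ ^ e ≤ 1 / (256 * L ^ 2 * V) ∧ 0 < κ :=
    ((eventually_rpow_le one_pos one_pos).and
      ((eventually_rpow_le hβ (by positivity)).and ((eventually_rpow_le (by positivity) hc0).and
      ((eventually_rpow_le he0 (by positivity)).and self_mem_nhdsWithin)))).exists
  rw [Real.rpow_one] at hκ1
  -- The term `d / q` leaves room for at least one cell per box (`hρq`); the term `2 / e` brings the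
  -- information below order `1 / M ^ 2` (`hρe`).
  obtain ⟨k, hk⟩ : ∃ k : ℝ, k = d / q + 2 / e := ⟨_, rfl⟩
  have hk0 : 0 < k := by rw [hk]; positivity
  -- In the exponent of `1 / M`, the `2` comes from the window length and the batch probability, `d`
  -- from the number of cells, and the rest from the scaling of the radius.
  refine ⟨c ^ d * L * V * κ ^ (β * (1 + α)) / (8 * 2 ^ d * (2 ^ β * 2 ^ d)),
    2 + d + k * (β * (1 + α)), by positivity, by positivity, ?_⟩
  intro T M hT hM S _ ν _ p
  have hM0 : (0 : ℝ) < M := by exact_mod_cast hM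
  have hM1 : (1 : ℝ) ≤ M := by exact_mod_cast hM
  obtain ⟨m, hm⟩ : ∃ m : ℝ, m = 1 / (M : ℝ) := ⟨_, rfl⟩
  rw [← hm]
  have hm0 : 0 < m := by rw [hm]; positivity
  have hm1 : m ≤ 1 := by rw [hm]; exact (div_le_one hM0).2 hM1
  have hMm : (M : ℝ) = 1 / m := by rw [hm]; field_simp
  obtain ⟨ρ, hρ⟩ : ∃ ρ : ℝ, ρ = κ * m ^ k := ⟨_, rfl⟩
  have hρ0 : 0 < ρ := by rw [hρ]; positivity
  have hρκ : ρ ≤ κ := by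
    rw [hρ]; exact mul_le_of_le_one_right hκ0.le (Real.rpow_le_one hm0.le hm1 hk0.le)
  have hρq : ρ ^ (q / d) ≤ c * m := by
    have h := rpow_scaled_le (s := 1) (k := k) hκ0 hm0 hm1 hκ3 (by
      have : k * (q / d) = 1 + 2 / e * (q / d) := by rw [hk]; field_simp
      rw [this]
      have : 0 < 2 / e * (q / d) := by positivity
      linarith)
    rwa [Real.rpow_one, ← hρ] at h
  have hρe : 16 * (L ^ 2 * V * ρ ^ e) ≤ (1 / (4 * (M : ℝ))) ^ 2 := by
    have h := rpow_scaled_le (s := 2) (k := k) hκ0 hm0 hm1 hκ4 (by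
      have : k * e = d / q * e + 2 := by rw [hk]; field_simp
      rw [this]
      have : 0 < d / q * e := by positivity
      linarith)
    rw [← hρ, Real.rpow_two] at h
    calc 16 * (L ^ 2 * V * ρ ^ e)
        ≤ 16 * (L ^ 2 * V * (1 / (256 * L ^ 2 * V) * m ^ 2)) := by gcongr
      _ = (1 / (4 * (M : ℝ))) ^ 2 := by rw [hm]; field_simp; norm_num
  obtain ⟨a, τ, h0, ha, hτ⟩ := exists_thresholds (gammaExp_pos (d := d) hα hβ)
    (gammaExp_lt_one hd hβ hαβ) hT hM
  obtain ⟨r, hr⟩ : ∃ r : ℕ → ℝ, r = fun i => ρ * τ i ^ (-(1 / (2 * β + d))) := ⟨_, rfl⟩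
  have hrf : ∀ i < M, 0 < r i ∧ r i ≤ ρ ∧ τ i * r i ^ e = ρ ^ e ∧
      τ i ^ gammaExp d α β * r i ^ (β * (1 + α)) = ρ ^ (β * (1 + α)) := fun i hi => by
    rw [hr, he]
    exact radius_facts hβ hρ0 (hτ i hi).1
  obtain ⟨K, hK⟩ : ∃ K : ℕ → ℕ, K = fun i => ⌊c * m * r i ^ (-(q / d))⌋₊ := ⟨_, rfl⟩
  have hKf : ∀ i < M, r i * (2 * M * K i) ≤ 1 ∧
      (K i : ℝ) ^ d ≤ c ^ d * m ^ d * r i ^ (-q) ∧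
      c ^ d * m ^ d * r i ^ (-q) / 2 ^ d ≤ (K i : ℝ) ^ d := fun i hi => by
    obtain ⟨hr0, hrρ, -, -⟩ := hrf i hi
    rw [hK, hMm]
    exact floor_cell_facts hd hqd hc0 hc2 hm0 hr0 (hrρ.trans (hρκ.trans hκ1))
      ((Real.rpow_le_rpow hr0.le hrρ (by positivity)).trans hρq)
  have hφ := isBumpFamily_cellBump (K := K) hd hβ hL (fun j hj => (hrf j hj).1) (fun j hj => by
      obtain ⟨hr0, hrρ, -, -⟩ := hrf j hj
      have h1 := (Real.rpow_le_rpow hr0.le (hrρ.trans hρκ) hβ.le).trans hκ2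
      refine (mul_le_mul_of_nonneg_left h1 hL.le).trans (le_of_eq ?_)
      field_simp) fun j hj => (hKf j hj).1
  obtain ⟨σ, hσ⟩ := exists_le_regret_cellBump (d := d) hβ hL hM (fun j hj => (hrf j hj).1)
    (fun j hj => (hKf j hj).1) hφ ν p h0 ha
    (b := c ^ d * L * V * κ ^ (β * (1 + α)) / (8 * 2 ^ d * (2 ^ β * 2 ^ d)) *
      m ^ (2 + d + k * (β * (1 + α))) *
      (T : ℝ) ^ ((1 - gammaExp d α β) / (1 - gammaExp d α β ^ M))) (fun i hi => by
      obtain ⟨hr0, -, hre, -⟩ := hrf i hi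
      refine le_trans ?_ hρe
      rw [← hre, ← he]
      have h1 := mul_le_mul_of_nonneg_right (hτ i hi).2.1
        (by positivity : 0 ≤ L ^ 2 * V * r i ^ e)
      linarith) (fun i hi => by
      obtain ⟨hr0, -, -, hrγ⟩ := hrf i hi
      have hT0 : (0 : ℝ) < T := by exact_mod_cast hT
      have h4M : 1 / (4 * (M : ℝ)) = m / 4 := by rw [hm]; field_simp
      have hW := (hτ i hi).2.2
      rw [← hm] at hW
      rw [hρ] at hrγ
      rw [h4M]
      exact cell_regret_le hq hL hV hc0 hm0 hκ0 hr0 (by linarith [(hτ i hi).1])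
        (Real.rpow_pos_of_pos hT0 _) hrγ hW (hKf i hi).2.2)
  refine ⟨_, gapInstance_cellBump_mem hd hα hβ hβ1 hαβ hL hM (fun j hj => (hrf j hj).1)
    (fun j hj => ?_) hφ σ, hσ⟩
  obtain ⟨hr0, -, -, -⟩ := hrf j hj
  have h2 : r j ^ (-q) * r j ^ q = 1 := by
    rw [← Real.rpow_add hr0]; simp
  have h3 : m ^ d ≤ m := by
    calc m ^ d ≤ m ^ 1 := pow_le_pow_of_le_one hm0.le hm1 hd
      _ = m := pow_one m
  have h5 := (hKf j hj).2.1
  rw [← hq]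
  calc (M : ℝ) * ((K j : ℝ) ^ d * (V * d * r j ^ q))
      ≤ M * ((c ^ d * m ^ d * r j ^ (-q)) * (V * d * r j ^ q)) := by gcongr
    _ = (V * d * c ^ d) * (M * m ^ d) * (r j ^ (-q) * r j ^ q) := by ring
    _ = (V * d * c ^ d) * (M * m ^ d) := by rw [h2, mul_one]
    -- Since `d ≥ 1`, the factor `m ^ d ≤ m` pays for the sum over the `M` scales.
    _ ≤ (D₀ * L ^ α) * (M * m) := by gcongr
    _ = D₀ * L ^ α := by rw [hMm]; field_simp

end Assembly

/-! ### The boundary case `d = 1`, `α * β = 1`. -/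

section SingleBump

variable {α β L δ₀ D₀ : ℝ}

lemma uniformCube_one_slab_le {u v : ℝ} (huv : u ≤ v) :
    (uniformCube 1).real {x | u ≤ x 0 ∧ x 0 ≤ v} ≤ v - u := by
  have e : {x : Ctx 1 | u ≤ x 0 ∧ x 0 ≤ v}
      = (MeasurableEquiv.toLp 2 (Fin 1 → ℝ)).symm ⁻¹' (Set.Icc (fun _ => u) fun _ => v) := by
    ext x
    simp only [Set.mem_ofPred_eq, Set.mem_preimage, Set.mem_Icc, Pi.le_def]
    constructor
    · rintro ⟨h1, h2⟩
      exact ⟨fun i => by rw [Fin.fin_one_eq_zero i]; exact h1,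
        fun i => by rw [Fin.fin_one_eq_zero i]; exact h2⟩
    · rintro ⟨h1, h2⟩
      exact ⟨h1 0, h2 0⟩
  have hvol : (volume : Measure (Ctx 1)) {x | u ≤ x 0 ∧ x 0 ≤ v} = ENNReal.ofReal (v - u) := by
    rw [e, (EuclideanSpace.volume_preserving_symm_measurableEquiv_toLp (Fin 1)).measure_preimage
      measurableSet_Icc.nullMeasurableSet, Real.volume_Icc_pi]
    simp
  refine (uniformCube_real_le (by rw [hvol]; exact ENNReal.ofReal_ne_top)).trans ?_
  unfold Measure.real
  rw [hvol, ENNReal.toReal_ofReal (by linarith)]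

lemma norm_ctx_one (x : Ctx 1) : ‖x‖ = |x 0| := by
  rw [EuclideanSpace.norm_eq]
  simp [Real.sqrt_sq_eq_abs]

/-- Within the cube, the complement of a ball around the corner `0` is a slab of length `1 - s`. -/
lemma le_uniformCube_one_ball {s : ℝ} (hs1 : s ≤ 1) :
    s ≤ (uniformCube 1).real (Metric.ball 0 s) := by
  have h1 : (uniformCube 1).real {x | s ≤ x 0 ∧ x 0 ≤ 1} ≤ 1 - s := uniformCube_one_slab_le hs1
  have h2 : ∀ᵐ x ∂(uniformCube 1), x ∈ cube 1 :=
    ae_restrict_mem (measurableSet_cube 1)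
  have h3 : (uniformCube 1).real (Metric.ball 0 s)ᶜ
      ≤ (uniformCube 1).real {x | s ≤ x 0 ∧ x 0 ≤ 1} := by
    refine ENNReal.toReal_mono (measure_ne_top _ _) (measure_mono_ae ?_)
    filter_upwards [h2] with x hx hxs
    have hx0 := hx 0
    have hxs' : ¬ x ∈ Metric.ball 0 s := hxs
    rw [Metric.mem_ball, dist_zero_right, norm_ctx_one, abs_of_nonneg hx0.1, not_lt] at hxs'
    exact ⟨hxs', hx0.2⟩
  have h4 := probReal_compl_eq_one_sub (μ := uniformCube 1)
    (measurableSet_ball (x := (0 : Ctx 1)) (ε := s))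
  linarith

/-- A bump of one sign at the boundary point `0` satisfies the sharp margin condition. -/
lemma uniformCube_one_bump_level_le {C r : ℝ} (hC : 0 < C) (hβ : 0 < β) (hαβ : α * β = 1)
    {δ : ℝ} (hδ : 0 ≤ δ) :
    (uniformCube 1).real {x | 0 < bump C β r 0 x ∧ bump C β r 0 x ≤ δ} ≤ (δ / C) ^ α := by
  have hα : α = β⁻¹ := eq_inv_of_mul_eq_one_left hαβ
  have h0 : 0 ≤ (δ / C) ^ β⁻¹ := Real.rpow_nonneg (by positivity) _
  have h1 : (uniformCube 1).real {x | 0 < bump C β r 0 x ∧ bump C β r 0 x ≤ δ}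
      ≤ (uniformCube 1).real {x | r - (δ / C) ^ β⁻¹ ≤ x 0 ∧ x 0 ≤ r} := by
    refine ENNReal.toReal_mono (measure_ne_top _ _) (measure_mono_ae ?_)
    filter_upwards [ae_restrict_mem (measurableSet_cube 1)] with x hx hxs
    obtain ⟨a1, a2⟩ := bump_level_subset hC hβ hxs
    rw [sub_zero, norm_ctx_one, abs_of_nonneg (hx 0).1] at a1 a2
    exact ⟨a2, a1.le⟩
  rw [hα]
  refine h1.trans ((uniformCube_one_slab_le (by linarith)).trans (le_of_eq (by ring)))

/-- The lower bound in the boundary case, in which there is room for a single bump only. -/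
lemma exists_lower_bound_of_eq (hα : 0 < α) (hβ : 0 < β) (hβ1 : β ≤ 1) (hαβ : α * β = 1)
    (hL : 0 < L) (hclass : 1 ≤ D₀ * (2 * L) ^ α) :
    ∃ D₁ D₂ : ℝ, 0 < D₁ ∧ 0 < D₂ ∧ ∀ T M : ℕ, 1 ≤ T → 1 ≤ M →
      ∀ (S : Type*) [MeasurableSpace S] (ν : Measure S) [IsProbabilityMeasure ν]
        (p : BatchPolicy 1 T M S), ∃ I ∈ instanceClass (uniformCube 1) α β L δ₀ D₀,
          D₁ * (1 / (M : ℝ)) ^ D₂ *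
            (T : ℝ) ^ ((1 - gammaExp 1 α β) / (1 - gammaExp 1 α β ^ M)) ≤ regret ν p I := by
  set V := ballVol 1 with hVdef
  have hV : 0 < V := ballVol_pos 1
  obtain ⟨e, he⟩ : ∃ e : ℝ, e = 2 * β + (1 : ℕ) := ⟨_, rfl⟩
  have he0 : 0 < e := by rw [he]; positivity
  obtain ⟨κ, hκ1, hκ2, hκ4, hκ0⟩ : ∃ κ : ℝ, κ ^ (1 : ℝ) ≤ 1 ∧ κ ^ β ≤ 1 / (4 * L) ∧
      κ ^ e ≤ 1 / (256 * L ^ 2 * V) ∧ 0 < κ :=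
    ((eventually_rpow_le one_pos one_pos).and ((eventually_rpow_le hβ (by positivity)).and
      ((eventually_rpow_le he0 (by positivity)).and self_mem_nhdsWithin))).exists
  rw [Real.rpow_one] at hκ1
  obtain ⟨k, hk⟩ : ∃ k : ℝ, k = 2 / e := ⟨_, rfl⟩
  have hk0 : 0 < k := by rw [hk]; positivity
  -- The `3` counts one factor `1 / M` from the window length and two from the batch probability and
  -- the random scale.
  refine ⟨L * κ ^ (β * (1 + α)) / (8 * 2 ^ β), 3 + k * (β * (1 + α)), by positivity,
    by positivity, ?_⟩
  intro T M hT hM S _ ν _ p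
  have hM0 : (0 : ℝ) < M := by exact_mod_cast hM
  have hM1 : (1 : ℝ) ≤ M := by exact_mod_cast hM
  obtain ⟨m, hm⟩ : ∃ m : ℝ, m = 1 / (M : ℝ) := ⟨_, rfl⟩
  rw [← hm]
  have hm0 : 0 < m := by rw [hm]; positivity
  have hm1 : m ≤ 1 := by rw [hm]; exact (div_le_one hM0).2 hM1
  obtain ⟨ρ, hρ⟩ : ∃ ρ : ℝ, ρ = κ * m ^ k := ⟨_, rfl⟩
  have hρ0 : 0 < ρ := by rw [hρ]; positivity
  have hρκ : ρ ≤ κ := by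
    rw [hρ]; exact mul_le_of_le_one_right hκ0.le (Real.rpow_le_one hm0.le hm1 hk0.le)
  have hρe : 4 * ((2 * L) ^ 2 * V * ρ ^ e) ≤ (1 / (4 * (M : ℝ))) ^ 2 := by
    have h := rpow_scaled_le (s := 2) (k := k) hκ0 hm0 hm1 hκ4 (by rw [hk]; field_simp; rfl)
    rw [← hρ, Real.rpow_two] at h
    calc 4 * ((2 * L) ^ 2 * V * ρ ^ e)
        ≤ 4 * ((2 * L) ^ 2 * V * (1 / (256 * L ^ 2 * V) * m ^ 2)) := by gcongr
      _ = (1 / (4 * (M : ℝ))) ^ 2 := by rw [hm]; field_simp; norm_num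
  obtain ⟨a, τ, h0, ha, hτ⟩ := exists_thresholds (gammaExp_pos (d := 1) hα hβ)
    (gammaExp_lt_one le_rfl hβ hαβ.le) hT hM
  -- The default `ρ` keeps the bump family admissible for every index, also where nothing is known
  -- about `τ i`.
  obtain ⟨r, hr⟩ : ∃ r : ℕ → ℝ, r = fun i =>
      if i < M then ρ * τ i ^ (-(1 / (2 * β + (1 : ℕ)))) else ρ := ⟨_, rfl⟩
  have hrf : ∀ i < M, 0 < r i ∧ r i ≤ ρ ∧ τ i * r i ^ e = ρ ^ e ∧
      τ i ^ gammaExp 1 α β * r i ^ (β * (1 + α)) = ρ ^ (β * (1 + α)) := fun i hi => by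
    rw [hr, he]
    simp only [if_pos hi]
    exact radius_facts hβ hρ0 (hτ i hi).1
  have hrb : ∀ i, 0 < r i ∧ r i ≤ ρ := fun i => by
    by_cases hi : i < M
    · exact ⟨(hrf i hi).1, (hrf i hi).2.1⟩
    · simp [hr, hi, hρ0]
  have h2L : (0 : ℝ) < 2 * L := by positivity
  -- A single bump of constant sign does not need the factor `2` for pairs of bumps, so it can use
  -- the full Hölder constant `2 * L`. At the endpoint `0` its level sets are one-sided, so `1 ≤ D₀
  -- * (2 * L) ^ α` is just what the margin condition asks for.
  have hφ : ∀ i, IsBumpFamily fun _ : Unit => bump (d := 1) (2 * L) β (r i) 0 := fun i =>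
    ⟨fun _ => measurable_bump, fun _ x => bump_nonneg h2L.le x, fun _ x => by
      refine (bump_le h2L.le hβ.le (hrb i).1.le x).trans ?_
      have h1 := (Real.rpow_le_rpow (hrb i).1.le ((hrb i).2.trans hρκ) hβ.le).trans hκ2
      refine (mul_le_mul_of_nonneg_left h1 h2L.le).trans (le_of_eq ?_)
      field_simp
      norm_num, fun _ _ _ _ _ => rfl⟩
  have hT0 : (0 : ℝ) < T := by exact_mod_cast hT
  obtain ⟨Q, hQ⟩ : ∃ Q : ℝ, Q = (T : ℝ) ^ ((1 - gammaExp 1 α β) / (1 - gammaExp 1 α β ^ M)) :=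
    ⟨_, rfl⟩
  have hQ0 : 0 < Q := by rw [hQ]; exact Real.rpow_pos_of_pos hT0 _
  obtain ⟨i, hi, arm, hreg⟩ := exists_le_regret_of_single_bump ν p hM hφ h0 ha
    (b := L * κ ^ (β * (1 + α)) / (8 * 2 ^ β) * m ^ (3 + k * (β * (1 + α))) * Q)
    (fun i hi => by
      obtain ⟨hr0, -, hre, -⟩ := hrf i hi
      have h1 := integral_bump_sq_le (d := 1) (C := 2 * L) (z := 0) h2L.le hβ hr0
      rw [← he] at h1
      refine le_trans ?_ hρe
      rw [← hre]
      have h2 := mul_le_mul (hτ i hi).2.1 h1 (integral_nonneg fun _ => sq_nonneg _)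
        (by linarith [(hτ i hi).1])
      have h3 : τ i * ((2 * L) ^ 2 * ballVol 1 * r i ^ e)
          = (2 * L) ^ 2 * V * (τ i * r i ^ e) := by rw [hVdef]; ring
      linarith) (fun i hi => by
      obtain ⟨hr0, hrρ, -, hrγ⟩ := hrf i hi
      have hτ0 : 0 < τ i := by linarith [(hτ i hi).1]
      have hW := (hτ i hi).2.2
      rw [← hm, ← hQ] at hW
      have hw := le_integral_bump (d := 1) (C := 2 * L) (z := 0) h2L.le hβ hr0
      have hball := le_uniformCube_one_ball (s := r i / 2)
        (by linarith [hrρ.trans (hρκ.trans hκ1)])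
      have hw2 : 2 * L * (r i / 2) ^ β * (r i / 2)
          ≤ ∫ x, bump (d := 1) (2 * L) β (r i) 0 x ∂(uniformCube 1) :=
        (mul_le_mul_of_nonneg_left hball (by positivity)).trans hw
      have h4M : 1 / (4 * (M : ℝ) ^ 2) = m ^ 2 / 4 := by rw [hm]; field_simp
      have hexp : r i ^ β * r i = r i ^ (β * (1 + α)) := by
        rw [← Real.rpow_add_one hr0.ne']
        congr 1
        linarith
      have hmexp : m ^ (3 + k * (β * (1 + α))) = m ^ 3 * m ^ (k * (β * (1 + α))) := by
        rw [Real.rpow_add hm0]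
        norm_num
      rw [hρ, Real.mul_rpow hκ0.le (by positivity), ← Real.rpow_mul hm0.le, ← hexp] at hrγ
      rw [h4M]
      calc L * κ ^ (β * (1 + α)) / (8 * 2 ^ β) * m ^ (3 + k * (β * (1 + α))) * Q
          = L / (8 * 2 ^ β) * m ^ 3 * Q *
              (κ ^ (β * (1 + α)) * m ^ (k * (β * (1 + α)))) := by rw [hmexp]; ring
        _ = (Q * τ i ^ gammaExp 1 α β * (m / 2)) * (2 * L * (r i / 2) ^ β * (r i / 2))
              * (m ^ 2 / 4) := by
            rw [← hrγ, Real.div_rpow hr0.le two_pos.le]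
            field_simp
            ring
        _ ≤ _ := by
            refine mul_le_mul_of_nonneg_right ?_ (by positivity)
            exact mul_le_mul hW hw2 (by positivity) (le_trans (by positivity) hW))
  rw [← hQ]
  refine ⟨_, gapInstance_mem ((hφ i).isGap fun _ => arm) ?_ ?_, hreg⟩
  · intro x _ y _
    have e1 : bumpGap (fun _ : Unit => bump (d := 1) (2 * L) β (r i) 0) (fun _ => arm) x
        - bumpGap (fun _ : Unit => bump (d := 1) (2 * L) β (r i) 0) (fun _ => arm) y
        = armSign arm * (bump (2 * L) β (r i) 0 x - bump (2 * L) β (r i) 0 y) := by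
      simp only [bumpGap, Finset.univ_unique, Finset.sum_singleton]
      ring
    have hs : |armSign arm| = 1 := by unfold armSign; split_ifs <;> simp
    rw [e1, abs_mul, hs, one_mul]
    exact abs_bump_sub_le h2L.le hβ.le hβ1 x y
  · intro δ hδ
    refine ((hφ i).uniformCube_level_le (fun _ => arm) δ).trans ?_
    simp only [Finset.univ_unique, Finset.sum_singleton]
    refine (uniformCube_one_bump_level_le h2L hβ hαβ hδ).trans ?_
    have h4 : (2 * L) ^ α * (δ / (2 * L)) ^ α = δ ^ α := by
      rw [← Real.mul_rpow h2L.le (by positivity)]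
      congr 1
      field_simp
    calc (δ / (2 * L)) ^ α = 1 * (δ / (2 * L)) ^ α := (one_mul _).symm
      _ ≤ D₀ * (2 * L) ^ α * (δ / (2 * L)) ^ α := by gcongr
      _ = D₀ * δ ^ α := by rw [mul_assoc, h4]

end SingleBump

end BatchedBandit

theorem theorem2 (d : ℕ) (hd : 1 ≤ d) (α β L δ₀ D₀ : ℝ) (hα : 0 < α) (hβ : 0 < β) (hβ1 : β ≤ 1)
    (hαβ : α * β ≤ 1) (hL : 0 < L) (hδ₀ : 0 < δ₀) (hδ₀1 : δ₀ < 1) (hD₀ : 0 < D₀)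
    (hclass : α * β < d ∨ 1 ≤ D₀ * (2 * L) ^ α) :
    ∃ D₁ D₂ : ℝ, 0 < D₁ ∧ 0 < D₂ ∧
      ∀ T M : ℕ, 1 ≤ T → 1 ≤ M →
      ∀ (S : Type*) [MeasurableSpace S] (ν : Measure S) [IsProbabilityMeasure ν]
        (p : BatchedBandit.BatchPolicy d T M S),
        ∃ I ∈ BatchedBandit.instanceClass (BatchedBandit.uniformCube d) α β L δ₀ D₀,
          D₁ * (1 / (M : ℝ)) ^ D₂ *
              (T : ℝ) ^ ((1 - BatchedBandit.gammaExp d α β) /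
                (1 - BatchedBandit.gammaExp d α β ^ M))
            ≤ BatchedBandit.regret ν p I := by
  by_cases hlt : α * β < d
  · exact BatchedBandit.exists_lower_bound_of_lt hd hα hβ hβ1 hαβ hL hD₀ hlt
  · have hd1 : d = 1 := by
      have h : (d : ℝ) ≤ 1 := (not_lt.1 hlt).trans hαβ
      have : d ≤ 1 := by exact_mod_cast h
      omega
    subst hd1
    have hαβ1 : α * β = 1 := le_antisymm hαβ (by simpa using hlt)
    exact BatchedBandit.exists_lower_bound_of_eq hα hβ hβ1 hαβ1 hL (hclass.resolve_left hlt)
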